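/- Let $k$ be a field complete for a (possibly trivial) non-archimedean absolute value and let $\Gamma$ be a subgroup of $\mathbf R_{>0}$. For a ring $A$ with a submultiplicative ultrametric seminorm $\|\cdot\|$ with $\|1\|\le 1$, the residue ring of $(A,\|\cdot\|)$ is the $\Gamma$-graded ring $\bigoplus_{\gamma\in\Gamma}\{\|a\|\le\gamma\}/\{\|a\|<\gamma\}$; if $\|a\|\in\Gamma$, write $\widetilde a$ for the class of $a$ in degree $\|a\|$. Let $\widetilde k$ be the residue ring of $k$. Let $r=(r_1,\dots,r_n)$ be a family of elements of $\Gamma$, and let $k\{T/r\}$ be the algebra of power series $\sum c_JT^J$ with $|c_J|r^J\to0$, with the norm $\max|c_J|r^J$. Its residue ring is identified with $\widetilde k[r\backslash T]$, the polynomial ring $\widetilde k[T_1,\dots,T_n]$ graded so that $T_i$ has degree $r_i$. Let $I$ be an ideal of $k\{T/r\}$ and let $(a_1,\dots,a_m)$ be a strongly generating family of $I$ with $\|a_i\|\in\Gamma$ for all $i$; that is, the $a_i$ are nonzero elements of $I$ and every $x\in I$ can be written $x=\sum b_ia_i$ with $b_i\in k\{T/r\}$ and $\|x\|=\max\|b_i\|\,\|a_i\|$.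 Let $A=k\{T/r\}/I$, with quotient norm $\|\cdot\|_{\mathrm q}$, let $|a|_{\mathrm{sp}}=\lim_n\|a^n\|_{\mathrm q}^{1/n}$ be its spectral seminorm, and let $\widetilde A_{\mathrm q}$ and $\widetilde A$ be the residue rings of $(A,\|\cdot\|_{\mathrm q})$ and $(A,|\cdot|_{\mathrm{sp}})$. Then: 1. $\|\cdot\|_{\mathrm q}$ is a submultiplicative norm on $A$ with values in $|k|\cdot\Gamma$. 2. The surjection $k\{T/r\}\to A$ induces an isomorphism of graded rings $\widetilde k[r\backslash T]/(\widetilde{a_1},\dots,\widetilde{a_m})\simeq\widetilde A_{\mathrm q}$. 3. The following are equivalent: (i) the surjection $k\{T/r\}\to A$ is distinguished, i.e. every $a\in A$ has a preimage $b$ with $\|b\|=|a|_{\mathrm{sp}}$; (ii) the surjection $k\{T/r\}\to A$ induces an isomorphism of graded $\widetilde k$-algebras $\widetilde k[r\backslash T]/(\widetilde{a_1},\dots,\widetilde{a_m})\simeq\widetilde A$; (iii) the graded ring $\widetilde k[r\backslash T]/(\widetilde{a_1},\dots,\widetilde{a_m})$ is reduced, i.e. has no nonzero nilpotent homogeneous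 element. -/

import Mathlib

open scoped DirectSum

noncomputable section

namespace GradedReduction

/-- The multiplicative group of positive real numbers. -/
abbrev PosReal : Type := {x : ℝ // 0 < x}

/-! ### Tate algebras with the Gauss norm -/

section Tate

variable (k : Type*) [NormedField k] [IsUltrametricDist k] {n : ℕ}

/-- The algebra `k{T/ρ}` of the power series `∑ c_J T^J` such that `|c_J| ρ^J → 0`. -/
def TateAlgebra (ρ : Fin n → PosReal) : Type _ :=
  MvPowerSeries.IsRestricted.subring (R := k) (fun i => (ρ i : ℝ))

namespace TateAlgebra

variable {k} {ρ : Fin n → PosReal}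

instance : CommRing (TateAlgebra k ρ) :=
  inferInstanceAs (CommRing (MvPowerSeries.IsRestricted.subring (R := k) (fun i => (ρ i : ℝ))))

/-- The underlying power series. -/
def toPowerSeries : TateAlgebra k ρ →+* MvPowerSeries (Fin n) k :=
  (MvPowerSeries.IsRestricted.subring (R := k) (fun i => (ρ i : ℝ))).subtype

theorem toPowerSeries_injective :
    Function.Injective (toPowerSeries : TateAlgebra k ρ → MvPowerSeries (Fin n) k) :=
  Subtype.val_injective

/-- The coefficient of `T^J`. -/
def coeff (J : Fin n →₀ ℕ) (f : TateAlgebra k ρ) : k := MvPowerSeries.coeff J (toPowerSeries f)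

/-- The constant series. -/
def C : k →+* TateAlgebra k ρ :=
  MvPowerSeries.C.codRestrict (MvPowerSeries.IsRestricted.subring (R := k) (fun i => (ρ i : ℝ)))
    (MvPowerSeries.isRestricted_C _)

/-- The coordinate function `T_i`. -/
def X (i : Fin n) : TateAlgebra k ρ :=
  ⟨MvPowerSeries.X i, MvPowerSeries.isRestricted_monomial _ _ _⟩

/-- The Gauss norm `‖∑ c_J T^J‖ = max |c_J| ρ^J`. -/
instance : Norm (TateAlgebra k ρ) :=
  ⟨fun f => MvPowerSeries.gaussNorm (fun c : k => ‖c‖) (fun i => (ρ i : ℝ)) (toPowerSeries f)⟩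

theorem norm_def (f : TateAlgebra k ρ) : ‖f‖ =
    MvPowerSeries.gaussNorm (fun c : k => ‖c‖) (fun i => (ρ i : ℝ)) (toPowerSeries f) := rfl

theorem tendsto_term (f : TateAlgebra k ρ) :
    Filter.Tendsto (fun J : Fin n →₀ ℕ => ‖coeff J f‖ * J.prod (fun i e => (ρ i : ℝ) ^ e))
      Filter.cofinite (nhds 0) := f.2

theorem hasGaussNorm (f : TateAlgebra k ρ) :
    MvPowerSeries.HasGaussNorm (fun c : k => ‖c‖) (fun i => (ρ i : ℝ)) (toPowerSeries f) :=
  (tendsto_term f).bddAbove_range_of_cofinite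

theorem term_le_norm (f : TateAlgebra k ρ) (J : Fin n →₀ ℕ) :
    ‖coeff J f‖ * J.prod (fun i e => (ρ i : ℝ) ^ e) ≤ ‖f‖ :=
  MvPowerSeries.le_gaussNorm _ _ _ (hasGaussNorm f) J

theorem isNonarchimedean_norm : IsNonarchimedean (fun c : k => ‖c‖) :=
  fun x y => IsUltrametricDist.norm_add_le_max x y

theorem norm_add_le_max' (f g : TateAlgebra k ρ) : ‖f + g‖ ≤ max ‖f‖ ‖g‖ := by
  rw [norm_def, norm_def, norm_def, map_add]
  exact MvPowerSeries.gaussNorm_add_le_max _ _ _ _ (fun i => (ρ i).2.le)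
    (fun a => norm_nonneg a) isNonarchimedean_norm (hasGaussNorm f) (hasGaussNorm g)

theorem norm_nonneg' (f : TateAlgebra k ρ) : 0 ≤ ‖f‖ :=
  MvPowerSeries.gaussNorm_nonneg _ _ _ (fun a => norm_nonneg a)

/-- The Gauss norm as a ring norm. -/
def gaussRingNorm : RingNorm (TateAlgebra k ρ) where
  toFun f := ‖f‖
  map_zero' := by rw [norm_def, map_zero]; exact MvPowerSeries.gaussNorm_zero _ _ norm_zero
  add_le' f g := (norm_add_le_max' f g).trans
    (max_le_add_of_nonneg (norm_nonneg' f) (norm_nonneg' g))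
  neg' f := by
    simp only [norm_def, map_neg]
    exact MvPowerSeries.gaussNorm_neg _ _ (fun a => norm_neg a) _
  mul_le' f g := by
    simp only [norm_def, map_mul]
    exact MvPowerSeries.gaussNorm_mul_le _ _ _ _ (fun i => (ρ i).2.le) (fun a => norm_nonneg a)
      (fun a b => (norm_mul a b).le) isNonarchimedean_norm norm_zero
      (hasGaussNorm f) (hasGaussNorm g)
  eq_zero_of_map_eq_zero' f hf := by
    apply toPowerSeries_injective
    rw [map_zero]
    exact (MvPowerSeries.gaussNorm_eq_zero_iff _ _ _ norm_zero (fun a => norm_nonneg a)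
      (fun a h => norm_eq_zero.1 h) (fun i => (ρ i).2) (hasGaussNorm f)).1 hf

instance : NormedCommRing (TateAlgebra k ρ) :=
  { (inferInstance : CommRing (TateAlgebra k ρ)), gaussRingNorm (k := k) (ρ := ρ).toNormedRing with
    norm := fun f => ‖f‖ }

instance : IsUltrametricDist (TateAlgebra k ρ) :=
  IsUltrametricDist.isUltrametricDist_of_isNonarchimedean_norm norm_add_le_max'

theorem norm_C_le (c : k) : ‖(C c : TateAlgebra k ρ)‖ ≤ ‖c‖ := by
  classical
  refine Real.iSup_le (fun J => ?_) (norm_nonneg c)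
  change ‖MvPowerSeries.coeff J (MvPowerSeries.C c)‖ * _ ≤ _
  rw [MvPowerSeries.coeff_C]
  split_ifs with h
  · simp [h]
  · simp

theorem norm_X_le (i : Fin n) : ‖(X i : TateAlgebra k ρ)‖ ≤ ρ i := by
  classical
  refine Real.iSup_le (fun J => ?_) (ρ i).2.le
  change ‖MvPowerSeries.coeff J (MvPowerSeries.X i : MvPowerSeries (Fin n) k)‖ * _ ≤ _
  rw [MvPowerSeries.coeff_X]
  split_ifs with h
  · simp [h]
  · simpa using (ρ i).2.le

theorem norm_one_le : ‖(1 : TateAlgebra k ρ)‖ ≤ 1 := by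
  simpa using norm_C_le (ρ := ρ) (1 : k)

end TateAlgebra

end Tate

/-! ### Ultrametric seminorms and residue rings -/

/-- A submultiplicative ultrametric seminorm with `‖1‖ ≤ 1`. -/
structure UltraSeminorm (A : Type*) [CommRing A] extends RingSeminorm A where
  nonarch' : ∀ a b, toFun (a + b) ≤ max (toFun a) (toFun b)
  one_le' : toFun 1 ≤ 1

namespace UltraSeminorm

variable {A : Type*} [CommRing A]

instance : CoeFun (UltraSeminorm A) (fun _ => A → ℝ) := ⟨fun ν => ν.toFun⟩

theorem map_zero (ν : UltraSeminorm A) : ν 0 = 0 := ν.map_zero'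
theorem map_neg (ν : UltraSeminorm A) (a : A) : ν (-a) = ν a := ν.neg' a
theorem nonneg (ν : UltraSeminorm A) (a : A) : 0 ≤ ν a := apply_nonneg ν.toRingSeminorm a

/-- The norm of an ultrametric seminormed ring. -/
def ofNorm (A : Type*) [SeminormedCommRing A] [IsUltrametricDist A] (h : ‖(1 : A)‖ ≤ 1) :
    UltraSeminorm A where
  toRingSeminorm := SeminormedRing.toRingSeminorm A
  nonarch' := fun a b => IsUltrametricDist.norm_add_le_max a b
  one_le' := h

/-- The spectral seminorm `lim ν (a ^ n) ^ (1 / n) = inf ν (a ^ n) ^ (1 / n)`. -/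
def spectral (ν : UltraSeminorm A) : UltraSeminorm A where
  toRingSeminorm := smoothingSeminorm ν.toRingSeminorm ν.one_le' ν.nonarch'
  nonarch' := isNonarchimedean_smoothingFun ν.toRingSeminorm ν.one_le' ν.nonarch'
  one_le' := smoothingFun_one_le ν.toRingSeminorm ν.one_le'

theorem spectral_apply (ν : UltraSeminorm A) (a : A) :
    ν.spectral a = ⨅ n : ℕ+, ν (a ^ (n : ℕ)) ^ (1 / ((n : ℕ) : ℝ)) := rfl

theorem spectral_le (ν : UltraSeminorm A) (a : A) : ν.spectral a ≤ ν a :=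
  smoothingFun_le_self ν.toRingSeminorm a

end UltraSeminorm

section Residue

variable (Γ : Subgroup PosReal) {A : Type*} [CommRing A] (ν : UltraSeminorm A)

/-- `{a ∈ A | ν a ≤ γ}`. -/
def leSubgroup (γ : PosReal) : AddSubgroup A where
  carrier := {a | ν a ≤ γ}
  zero_mem' := by
    change ν 0 ≤ γ
    rw [ν.map_zero]; exact γ.2.le
  add_mem' ha hb := (ν.nonarch' _ _).trans (max_le ha hb)
  neg_mem' {a} ha := by
    change ν (-a) ≤ γ
    rw [ν.map_neg]; exact ha

/-- `{a ∈ A | ν a < γ}`. -/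
def ltSubgroup (γ : PosReal) : AddSubgroup A where
  carrier := {a | ν a < γ}
  zero_mem' := by
    change ν 0 < γ
    rw [ν.map_zero]; exact γ.2
  add_mem' ha hb := (ν.nonarch' _ _).trans_lt (max_lt ha hb)
  neg_mem' {a} ha := by
    change ν (-a) < γ
    rw [ν.map_neg]; exact ha

variable {ν} in
theorem mem_leSubgroup {γ : PosReal} {a : A} : a ∈ leSubgroup ν γ ↔ ν a ≤ γ := Iff.rfl

/-- The graded piece `{a ∈ A | ν a ≤ γ} / {a ∈ A | ν a < γ}`. The index lives in `Additive Γ`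
because gradings are indexed by additive monoids in Mathlib. -/
def GradedPiece (γ : Additive Γ) : Type _ :=
  leSubgroup ν (γ.toMul : PosReal) ⧸
    (ltSubgroup ν (γ.toMul : PosReal)).addSubgroupOf (leSubgroup ν (γ.toMul : PosReal))

namespace GradedPiece

variable {Γ ν}

instance (γ : Additive Γ) : AddCommGroup (GradedPiece Γ ν γ) :=
  inferInstanceAs (AddCommGroup (_ ⧸
    (ltSubgroup ν (γ.toMul : PosReal)).addSubgroupOf (leSubgroup ν (γ.toMul : PosReal))))

/-- The class modulo `{ν < γ}` of an element of `{ν ≤ γ}`. -/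
def mk (γ : Additive Γ) : leSubgroup ν (γ.toMul : PosReal) →+ GradedPiece Γ ν γ :=
  QuotientAddGroup.mk' _

theorem mk_surjective (γ : Additive Γ) :
    Function.Surjective (mk γ : _ → GradedPiece Γ ν γ) := QuotientAddGroup.mk'_surjective _

theorem mk_eq_zero_iff (γ : Additive Γ) (a : leSubgroup ν (γ.toMul : PosReal)) :
    (mk γ a : GradedPiece Γ ν γ) = 0 ↔ ν (a : A) < (γ.toMul : PosReal) :=
  (QuotientAddGroup.eq_zero_iff a).trans Iff.rfl

/-- A homomorphism out of a graded piece. -/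
def lift (γ : Additive Γ) {B : Type*} [AddCommGroup B]
    (g : leSubgroup ν (γ.toMul : PosReal) →+ B)
    (hg : ∀ a : leSubgroup ν (γ.toMul : PosReal), ν (a : A) < (γ.toMul : PosReal) → g a = 0) : GradedPiece Γ ν γ →+ B :=
  QuotientAddGroup.lift _ g (fun a ha => hg a ha)

@[simp] theorem lift_mk (γ : Additive Γ) {B : Type*} [AddCommGroup B]
    (g : leSubgroup ν (γ.toMul : PosReal) →+ B) (hg) (a) :
    lift γ g hg (mk γ a) = g a := rfl

theorem mul_mem {γ δ : Additive Γ} {a b : A} (ha : ν a ≤ (γ.toMul : PosReal))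
    (hb : ν b ≤ (δ.toMul : PosReal)) : ν (a * b) ≤ ((γ + δ).toMul : PosReal) :=
  (ν.mul_le' a b).trans (mul_le_mul ha hb (ν.nonneg b) (γ.toMul : PosReal).2.le)

theorem mul_lt_left {γ δ : Additive Γ} {a b : A} (ha : ν a < (γ.toMul : PosReal))
    (hb : ν b ≤ (δ.toMul : PosReal)) : ν (a * b) < ((γ + δ).toMul : PosReal) :=
  (ν.mul_le' a b).trans_lt
    ((mul_le_mul_of_nonneg_left hb (ν.nonneg a)).trans_lt
      (mul_lt_mul_of_pos_right ha (δ.toMul : PosReal).2))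

theorem mul_lt_right {γ δ : Additive Γ} {a b : A} (ha : ν a ≤ (γ.toMul : PosReal))
    (hb : ν b < (δ.toMul : PosReal)) : ν (a * b) < ((γ + δ).toMul : PosReal) :=
  (ν.mul_le' a b).trans_lt
    ((mul_le_mul_of_nonneg_right ha (ν.nonneg b)).trans_lt
      (mul_lt_mul_of_pos_left hb (γ.toMul : PosReal).2))

/-- The product of representatives. -/
def mulRep {γ δ : Additive Γ} (a : leSubgroup ν (γ.toMul : PosReal))
    (b : leSubgroup ν (δ.toMul : PosReal)) : leSubgroup ν ((γ + δ).toMul : PosReal) :=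
  ⟨(a : A) * b, mem_leSubgroup.2 (mul_mem (mem_leSubgroup.1 a.2) (mem_leSubgroup.1 b.2))⟩

theorem mulRep_add {γ δ : Additive Γ} (a : leSubgroup ν (γ.toMul : PosReal))
    (b c : leSubgroup ν (δ.toMul : PosReal)) : mulRep a (b + c) = mulRep a b + mulRep a c :=
  Subtype.ext (mul_add _ _ _)

theorem add_mulRep {γ δ : Additive Γ} (a b : leSubgroup ν (γ.toMul : PosReal))
    (c : leSubgroup ν (δ.toMul : PosReal)) : mulRep (a + b) c = mulRep a c + mulRep b c :=
  Subtype.ext (add_mul _ _ _)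

/-- Multiplication by the class of `a`. -/
def mulLeft {γ : Additive Γ} (δ : Additive Γ) (a : leSubgroup ν (γ.toMul : PosReal)) :
    GradedPiece Γ ν δ →+ GradedPiece Γ ν (γ + δ) :=
  lift δ
    (AddMonoidHom.mk' (fun b => mk (γ + δ) (mulRep a b))
      (fun b c => by rw [mulRep_add, map_add]))
    (fun b hb => (mk_eq_zero_iff _ _).2 (mul_lt_right (mem_leSubgroup.1 a.2) hb))

theorem mulLeft_mk {γ δ : Additive Γ} (a : leSubgroup ν (γ.toMul : PosReal))
    (b : leSubgroup ν (δ.toMul : PosReal)) :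
    mulLeft δ a (mk δ b) = mk (γ + δ) (mulRep a b) := rfl

/-- The multiplication induced by that of `A`. -/
def mulHom (γ δ : Additive Γ) :
    GradedPiece Γ ν γ →+ GradedPiece Γ ν δ →+ GradedPiece Γ ν (γ + δ) :=
  lift γ
    (AddMonoidHom.mk' (mulLeft δ) (fun a b => by
      ext c
      obtain ⟨c, rfl⟩ := mk_surjective δ c
      rw [AddMonoidHom.add_apply, mulLeft_mk, mulLeft_mk, mulLeft_mk, add_mulRep, map_add]))
    (fun a ha => by
      ext b
      obtain ⟨b, rfl⟩ := mk_surjective δ b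
      exact (mk_eq_zero_iff _ _).2 (mul_lt_left ha (mem_leSubgroup.1 b.2)))

theorem mulHom_mk (γ δ : Additive Γ) (a : leSubgroup ν (γ.toMul : PosReal))
    (b : leSubgroup ν (δ.toMul : PosReal)) :
    mulHom γ δ (mk γ a) (mk δ b) = mk (γ + δ) (mulRep a b) := rfl

theorem gradedMonoid_ext {γ δ : Additive Γ} (h : γ = δ) {a : leSubgroup ν (γ.toMul : PosReal)}
    {b : leSubgroup ν (δ.toMul : PosReal)} (hab : (a : A) = b) :
    (GradedMonoid.mk γ (mk γ a) : GradedMonoid (GradedPiece Γ ν)) =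
      GradedMonoid.mk δ (mk δ b) := by
  subst h
  rw [Subtype.ext hab]

instance : GradedMonoid.GMul (GradedPiece Γ ν) where
  mul {γ δ} a b := mulHom γ δ a b

instance : GradedMonoid.GOne (GradedPiece Γ ν) where
  one := mk 0 ⟨1, mem_leSubgroup.2 ν.one_le'⟩

instance : DirectSum.GCommRing (GradedPiece Γ ν) where
  mul_zero {γ δ} a := _root_.map_zero (mulHom γ δ a)
  zero_mul {γ δ} b := by
    change mulHom γ δ 0 b = 0
    rw [_root_.map_zero]; rfl
  mul_add {γ δ} a b c := map_add (mulHom γ δ a) b c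
  add_mul {γ δ} a b c := by
    change mulHom γ δ (a + b) c = mulHom γ δ a c + mulHom γ δ b c
    rw [map_add]; rfl
  one_mul := by
    rintro ⟨γ, a⟩
    obtain ⟨a, rfl⟩ := mk_surjective γ a
    exact gradedMonoid_ext (zero_add γ) (one_mul (a : A))
  mul_one := by
    rintro ⟨γ, a⟩
    obtain ⟨a, rfl⟩ := mk_surjective γ a
    exact gradedMonoid_ext (add_zero γ) (mul_one (a : A))
  mul_assoc := by
    rintro ⟨γ, a⟩ ⟨δ, b⟩ ⟨ε, c⟩
    obtain ⟨a, rfl⟩ := mk_surjective γ a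
    obtain ⟨b, rfl⟩ := mk_surjective δ b
    obtain ⟨c, rfl⟩ := mk_surjective ε c
    exact gradedMonoid_ext (add_assoc γ δ ε) (mul_assoc (a : A) b c)
  mul_comm := by
    rintro ⟨γ, a⟩ ⟨δ, b⟩
    obtain ⟨a, rfl⟩ := mk_surjective γ a
    obtain ⟨b, rfl⟩ := mk_surjective δ b
    exact gradedMonoid_ext (add_comm γ δ) (mul_comm (a : A) b)
  natCast m := m • GradedMonoid.GOne.one
  natCast_zero := zero_nsmul _
  natCast_succ m := succ_nsmul _ m
  intCast m := m • GradedMonoid.GOne.one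
  intCast_ofNat m := natCast_zsmul _ m
  intCast_negSucc_ofNat m := negSucc_zsmul _ m

end GradedPiece

/-- The graded residue ring `⨁_{γ ∈ Γ} {ν ≤ γ} / {ν < γ}`. -/
abbrev ResidueRing : Type _ := ⨁ γ : Additive Γ, GradedPiece Γ ν γ

namespace ResidueRing

variable {Γ}

/-- The part of degree `γ` of the residue ring. -/
def degree (γ : Γ) : AddSubgroup (ResidueRing Γ ν) :=
  (DirectSum.of (GradedPiece Γ ν) (Additive.ofMul γ)).range

/-- The class of `a` in degree `γ`, where `ν a ≤ γ`. -/
def symbol (γ : Γ) (a : A) (h : ν a ≤ (γ : PosReal)) : ResidueRing Γ ν :=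
  DirectSum.of (GradedPiece Γ ν) (Additive.ofMul γ)
    (GradedPiece.mk (Additive.ofMul γ) ⟨a, mem_leSubgroup.2 h⟩)

variable (Γ) {ν} {B : Type*} [CommRing B] {μ : UltraSeminorm B}

/-- The homomorphism of residue rings induced by a contracting ring homomorphism. -/
def map (f : A →+* B) (hf : ∀ a, μ (f a) ≤ ν a) : ResidueRing Γ ν →+* ResidueRing Γ μ :=
  DirectSum.toSemiring
    (fun γ => (DirectSum.of (GradedPiece Γ μ) γ).comp
      (GradedPiece.lift γ
        (AddMonoidHom.mk' (fun a => GradedPiece.mk γ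
          ⟨f a, mem_leSubgroup.2 ((hf a).trans (mem_leSubgroup.1 a.2))⟩) (by
          intro a b
          rw [← map_add]
          congr 1
          exact Subtype.ext (map_add f _ _)))
        (fun a ha => (GradedPiece.mk_eq_zero_iff _ _).2 ((hf a).trans_lt ha))))
    (by
      rw [DirectSum.one_def]
      exact DirectSum.of_eq_of_gradedMonoid_eq
        (GradedPiece.gradedMonoid_ext rfl (map_one f)))
    (by
      intro γ δ a b
      obtain ⟨a, rfl⟩ := GradedPiece.mk_surjective γ a
      obtain ⟨b, rfl⟩ := GradedPiece.mk_surjective δ b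
      simp only [AddMonoidHom.comp_apply, DirectSum.of_mul_of]
      exact DirectSum.of_eq_of_gradedMonoid_eq
        (GradedPiece.gradedMonoid_ext rfl (map_mul f (a : A) b)))

theorem map_symbol (f : A →+* B) (hf : ∀ a, μ (f a) ≤ ν a) (γ : Γ) (a : A)
    (h : ν a ≤ (γ : PosReal)) :
    map Γ f hf (symbol ν γ a h) = symbol μ γ (f a) ((hf a).trans h) := by
  rw [map, symbol, DirectSum.toSemiring_of]; rfl

end ResidueRing

end Residue

/-! ### Generalities on graded rings -/

section Graded

variable {Γ : Type*} (R S : Type*) [CommRing R] [CommRing S]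

/-- A ring homomorphism is an isomorphism of graded rings. -/
def IsGradedIso (𝒜 : Γ → AddSubgroup R) (ℬ : Γ → AddSubgroup S) (f : R →+* S) : Prop :=
  Function.Bijective f ∧ ∀ γ, (𝒜 γ).map f.toAddMonoidHom = ℬ γ

/-- A graded ring is reduced: every nilpotent homogeneous element is zero. -/
def IsGradedReduced (𝒜 : Γ → AddSubgroup R) : Prop :=
  ∀ γ, ∀ x ∈ 𝒜 γ, IsNilpotent x → x = 0

/-- The grading induced on a quotient (by a homogeneous ideal). -/
def quotientDegree {R : Type*} [CommRing R] (𝒜 : Γ → AddSubgroup R) (J : Ideal R) (γ : Γ) : AddSubgroup (R ⧸ J) :=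
  (𝒜 γ).map (Ideal.Quotient.mk J).toAddMonoidHom

end Graded

/-! ### Polynomials over the residue field and reduction of restricted series -/

section Reduction

variable (k : Type*) [NormedField k] [IsUltrametricDist k] (Γ : Subgroup PosReal)

/-- The norm of the field `k`. -/
def fieldNorm : UltraSeminorm k := UltraSeminorm.ofNorm k norm_one.le

/-- The graded residue field of `k`. -/
abbrev ResidueField : Type _ := ResidueRing Γ (fieldNorm k)

variable {k Γ} {n : ℕ}

/-- The element `r^J` of `Γ`. -/
def radiusPow (r : Fin n → Γ) (J : Fin n →₀ ℕ) : Γ := J.prod (fun i e => r i ^ e)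

theorem coe_radiusPow (r : Fin n → Γ) (J : Fin n →₀ ℕ) :
    ((radiusPow r J : PosReal) : ℝ) = J.prod (fun i e => ((r i : PosReal) : ℝ) ^ e) := by
  have h : ∀ s : Finset (Fin n), (((∏ i ∈ s, r i ^ J i : Γ) : PosReal) : ℝ) =
      ∏ i ∈ s, ((r i : PosReal) : ℝ) ^ J i := by
    classical
    intro s
    induction s using Finset.induction_on with
    | empty => simp
    | insert i s hi ih => rw [Finset.prod_insert hi, Finset.prod_insert hi, ← ih]; simp
  exact h _

variable (k) in
/-- The part of degree `γ` of the graded polynomial ring over the residue field in which `T_i` has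
degree `r_i`: the polynomials `∑ c_J T^J` with `c_J` of degree `γ r^{-J}` for all `J`. -/
def polyDegree (r : Fin n → Γ) (γ : Γ) : AddSubgroup (MvPolynomial (Fin n) (ResidueField k Γ)) where
  carrier := {p | ∀ J, p.coeff J ∈ ResidueRing.degree (fieldNorm k) (γ * (radiusPow r J)⁻¹)}
  zero_mem' J := by rw [MvPolynomial.coeff_zero]; exact zero_mem _
  add_mem' hp hq J := by rw [MvPolynomial.coeff_add]; exact add_mem (hp J) (hq J)
  neg_mem' hp J := by rw [MvPolynomial.coeff_neg]; exact neg_mem (hp J)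

variable (k) in
/-- The Tate algebra `k{T/r}` for radii in `Γ`. -/
abbrev Tate (r : Fin n → Γ) : Type _ := TateAlgebra k (fun i => (r i : PosReal))

theorem norm_coeff_le {r : Fin n → Γ} {f : Tate k r} {γ : Γ} (h : ‖f‖ ≤ (γ : PosReal))
    (J : Fin n →₀ ℕ) :
    fieldNorm k (TateAlgebra.coeff J f) ≤ ((γ * (radiusPow r J)⁻¹ : Γ) : PosReal) := by
  have h1 := (TateAlgebra.term_le_norm f J).trans h
  rw [← coe_radiusPow] at h1
  have h2 : (0 : ℝ) < (radiusPow r J : PosReal) := (radiusPow r J : PosReal).2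
  change ‖TateAlgebra.coeff J f‖ ≤ ((γ : PosReal) : ℝ) * ((radiusPow r J : PosReal) : ℝ)⁻¹
  rwa [← div_eq_mul_inv, le_div_iff₀ h2]

theorem finite_leading {r : Fin n → Γ} (f : Tate k r) (γ : Γ) :
    {J : Fin n →₀ ℕ | ((γ : PosReal) : ℝ) ≤
      ‖TateAlgebra.coeff J f‖ * J.prod (fun i e => ((r i : PosReal) : ℝ) ^ e)}.Finite := by
  have h := (TateAlgebra.tendsto_term f).eventually (gt_mem_nhds (γ : PosReal).2)
  rw [Filter.eventually_cofinite] at h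
  simpa only [not_lt] using h

/-- The class of `f = ∑ c_J T^J` in degree `γ`, where `‖f‖ ≤ γ`: the polynomial `∑ [c_J] T^J`,
where `[c_J]` is the class of `c_J` in degree `γ r^{-J}`. Only the terms with `γ ≤ |c_J| r^J`
are written, since `[c_J] = 0` for the others. -/
def polySymbol {r : Fin n → Γ} (γ : Γ) (f : Tate k r) (h : ‖f‖ ≤ (γ : PosReal)) :
    MvPolynomial (Fin n) (ResidueField k Γ) :=
  ∑ J ∈ (finite_leading f γ).toFinset,
    MvPolynomial.monomial J
      (ResidueRing.symbol (fieldNorm k) (γ * (radiusPow r J)⁻¹) (TateAlgebra.coeff J f)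
        (norm_coeff_le h J))

/-- The homomorphism of algebras over the residue field, from the graded polynomial ring to the
residue ring of `(A, ν)`, induced by a contracting homomorphism `φ : k{T/r} → A`: it sends `T_i` to
the class of `φ(T_i)` in degree `r_i`. -/
def reductionHom {r : Fin n → Γ} {A : Type*} [CommRing A] (ν : UltraSeminorm A)
    (φ : Tate k r →+* A) (hφ : ∀ f, ν (φ f) ≤ ‖f‖) :
    MvPolynomial (Fin n) (ResidueField k Γ) →+* ResidueRing Γ ν :=
  MvPolynomial.eval₂Hom
    (ResidueRing.map Γ (φ.comp TateAlgebra.C)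
      (fun c => (hφ (TateAlgebra.C c)).trans (TateAlgebra.norm_C_le c)))
    (fun i => ResidueRing.symbol ν (r i) (φ (TateAlgebra.X i))
      ((hφ (TateAlgebra.X i)).trans (TateAlgebra.norm_X_le i)))

/-- `φ : k{T/r} → A` induces an isomorphism from the quotient by `J` of the graded polynomial ring
onto the residue ring of `(A, ν)`. -/
def InducesIso {r : Fin n → Γ} {A : Type*} [CommRing A] (ν : UltraSeminorm A)
    (φ : Tate k r →+* A) (hφ : ∀ f, ν (φ f) ≤ ‖f‖)
    (J : Ideal (MvPolynomial (Fin n) (ResidueField k Γ))) : Prop :=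
  ∃ h : ∀ p ∈ J, reductionHom ν φ hφ p = 0,
    IsGradedIso (MvPolynomial (Fin n) (ResidueField k Γ) ⧸ J) (ResidueRing Γ ν)
      (quotientDegree (polyDegree k r) J) (ResidueRing.degree ν)
      (Ideal.Quotient.lift J (reductionHom ν φ hφ) h)

end Reduction

/-! ### Quotients of Tate algebras, strong generation, distinguished homomorphisms -/

/-- A finite family `(m_i)` of nonzero elements of a seminormed `R`-module `M` is strongly
generating if every `x ∈ M` can be written `∑ b_i m_i` with `‖x‖ = max ‖b_i‖ ‖m_i‖`. -/
def IsStronglyGenerating (R : Type*) {M ι : Type*} [SeminormedCommRing R]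
    [SeminormedAddCommGroup M] [Module R M] [Fintype ι] (m : ι → M) : Prop :=
  (∀ i, m i ≠ 0) ∧
    ∀ x : M, ∃ b : ι → R, x = ∑ i, b i • m i ∧ ‖x‖ = ⨆ i, ‖b i‖ * ‖m i‖

section Quotient

variable {k : Type*} [NormedField k] [IsUltrametricDist k] {n : ℕ} {ρ : Fin n → PosReal}

/-- A homomorphism `φ : k{T/ρ} → A` is distinguished if every `a ∈ A` has a preimage whose norm is
the spectral seminorm of `a`. Here `ν` is the norm of the affinoid algebra `A`. -/
def IsDistinguished {A : Type*} [CommRing A] (ν : UltraSeminorm A)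
    (φ : TateAlgebra k ρ →+* A) : Prop :=
  ∀ a : A, ∃ b : TateAlgebra k ρ, φ b = a ∧ ‖b‖ = ν.spectral a

variable (I : Ideal (TateAlgebra k ρ))

theorem quotient_norm_add_le_max (x y : TateAlgebra k ρ ⧸ I) : ‖x + y‖ ≤ max ‖x‖ ‖y‖ := by
  refine le_of_forall_pos_lt_add (fun ε hε => ?_)
  obtain ⟨f, rfl, hf⟩ := Ideal.Quotient.norm_mk_lt x hε
  obtain ⟨g, rfl, hg⟩ := Ideal.Quotient.norm_mk_lt y hε
  rw [← map_add]
  refine (Ideal.Quotient.norm_mk_le I (f + g)).trans_lt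
    ((IsUltrametricDist.norm_add_le_max f g).trans_lt ?_)
  rw [← max_add_add_right]
  exact max_lt_max hf hg

instance : IsUltrametricDist (TateAlgebra k ρ ⧸ I) :=
  IsUltrametricDist.isUltrametricDist_of_isNonarchimedean_norm (quotient_norm_add_le_max I)

/-- The quotient norm `‖a‖ = inf {‖b‖ | b ∈ k{T/ρ} a preimage of a}` on `k{T/ρ}/I`. -/
def quotientNorm : UltraSeminorm (TateAlgebra k ρ ⧸ I) :=
  UltraSeminorm.ofNorm (TateAlgebra k ρ ⧸ I)
    ((Ideal.Quotient.norm_mk_le I 1).trans TateAlgebra.norm_one_le)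

theorem quotientNorm_eq (a : TateAlgebra k ρ ⧸ I) :
    quotientNorm I a = sInf ((fun b => ‖b‖) '' {b | Ideal.Quotient.mk I b = a}) := by
  have h0 : BddBelow ((fun b : TateAlgebra k ρ => ‖b‖) '' {b | Ideal.Quotient.mk I b = a}) :=
    ⟨0, by rintro _ ⟨c, -, rfl⟩; exact norm_nonneg c⟩
  change ‖a‖ = _
  refine le_antisymm (le_csInf ?_ ?_) (le_of_forall_pos_lt_add fun ε hε => ?_)
  · obtain ⟨b, hb⟩ := Ideal.Quotient.mk_surjective a
    exact ⟨_, b, hb, rfl⟩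
  · rintro _ ⟨b, rfl, rfl⟩
    exact Ideal.Quotient.norm_mk_le I b
  · obtain ⟨b, hb, hlt⟩ := Ideal.Quotient.norm_mk_lt a hε
    exact (csInf_le h0 ⟨b, hb, rfl⟩).trans_lt hlt

theorem quotientNorm_mk_le (f : TateAlgebra k ρ) :
    quotientNorm I (Ideal.Quotient.mk I f) ≤ ‖f‖ := Ideal.Quotient.norm_mk_le I f

theorem spectral_mk_le (f : TateAlgebra k ρ) :
    (quotientNorm I).spectral (Ideal.Quotient.mk I f) ≤ ‖f‖ :=
  (UltraSeminorm.spectral_le _ _).trans (quotientNorm_mk_le I f)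

end Quotient

/-- The ideal of the graded polynomial ring generated by the reductions of the `a_i`, where
`‖a_i‖ = d_i ∈ Γ`. -/
def reductionIdeal {k : Type*} [NormedField k] [IsUltrametricDist k] {Γ : Subgroup PosReal}
    {n m : ℕ} {r : Fin n → Γ} (a : Fin m → Tate k r) (d : Fin m → Γ)
    (hd : ∀ i, ‖a i‖ = (d i : PosReal)) : Ideal (MvPolynomial (Fin n) (ResidueField k Γ)) :=
  Ideal.span (Set.range fun i => polySymbol (d i) (a i) (hd i).le)

end GradedReduction

end

noncomputable section

namespace GradedReduction

/-! The core is that each class modulo `I` has a preimage whose norm is the quotient norm. Give a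
nonzero series the largest exponent, for a monomial order, among its terms of maximal absolute
value. By Dickson's lemma the leading exponents of `I` are governed by finitely many elements of
`I`, so one `ε < 1` bounds the terms beyond their leading ones. Division by these elements
(`exists_division`) makes the terms at leading exponents smaller by the factor `ε`. A preimage close
enough to optimal then becomes optimal (`norm_le_norm_sub`). This treats classes of nonzero norm,
without assuming that the value group is discrete. Classes of norm zero vanish because `I` is
closed: it is the image of a complete module under a map with bounded lifts
(`isClosed_of_isStronglyGenerating`).

Optimal preimages give the values in `|k|·Γ` and the surjectivity onto the residue ring. For the
kernel in degree `γ`, if the class of `f` has norm `< γ`, subtracting an optimal preimage moves `f`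
into `I` without changing its symbol. Strong generation says precisely that symbols of elements of
`I` lie in the ideal of the symbols of the `a_i` (`polySymbol_mem_reductionIdeal`).

For the equivalences, the first condition forces the quotient norm to be the spectral seminorm,
which gives the second. A power-multiplicative seminorm has a graded reduced residue ring.
Conversely, reducedness makes the quotient norm power-multiplicative on elements with norm in `Γ`;
scaling by `k` reaches all elements (`spectral_eq_quotientNorm`). -/

theorem exists_lt_one_forall_le_mul {ι : Type*} {g : ι → ℝ}
    (hg : Filter.Tendsto g Filter.cofinite (nhds 0)) {c : ℝ} (hc : 0 < c) (S : Set ι)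
    (h : ∀ i ∈ S, g i < c) : ∃ ε : ℝ, 0 < ε ∧ ε < 1 ∧ ∀ i ∈ S, g i ≤ ε * c := by
  have hfin : {i | c / 2 ≤ g i}.Finite := by
    have := hg.eventually (gt_mem_nhds (half_pos hc))
    rw [Filter.eventually_cofinite] at this
    simpa only [not_lt] using this
  -- Only finitely many values reach `c / 2`: either none of them is on `S` and `1 / 2` works, or
  -- the largest one, divided by `c`, does.
  obtain hS | hS := (S ∩ {i | c / 2 ≤ g i}).eq_empty_or_nonempty
  · refine ⟨1 / 2, by norm_num, by norm_num, fun i hi => ?_⟩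
    have : i ∉ S ∩ {i | c / 2 ≤ g i} := by simp [hS]
    have : ¬ c / 2 ≤ g i := fun hh => this ⟨hi, hh⟩
    linarith
  · obtain ⟨j, hj, hmax⟩ := Set.exists_max_image _ g (hfin.subset Set.inter_subset_right) hS
    have hj2 : c / 2 ≤ g j := hj.2
    refine ⟨g j / c, div_pos (by linarith) hc, (div_lt_one hc).2 (h j hj.1), fun i hi => ?_⟩
    rw [div_mul_cancel₀ _ hc.ne']
    by_cases hi2 : c / 2 ≤ g i
    · exact hmax i ⟨hi, hi2⟩
    · linarith

theorem norm_sub_le_max_norm {E : Type*} [SeminormedAddCommGroup E] [IsUltrametricDist E]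
    (x y : E) : ‖x - y‖ ≤ max ‖x‖ ‖y‖ := by
  rw [sub_eq_add_neg, ← norm_neg y]
  exact IsUltrametricDist.norm_add_le_max x (-y)

/-! ### Weights, terms and monomials of restricted series -/

/-- The weight `ρ^J`. -/
def weight {n : ℕ} (ρ : Fin n → PosReal) (J : Fin n →₀ ℕ) : ℝ :=
  J.prod (fun i e => (ρ i : ℝ) ^ e)

theorem weight_pos {n : ℕ} (ρ : Fin n → PosReal) (J : Fin n →₀ ℕ) : 0 < weight ρ J :=
  Finset.prod_pos fun i _ => pow_pos (ρ i).2 _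

theorem weight_add {n : ℕ} (ρ : Fin n → PosReal) (J K : Fin n →₀ ℕ) :
    weight ρ (J + K) = weight ρ J * weight ρ K :=
  Finsupp.prod_add_index' (by simp) (by simp [pow_add])

namespace TateAlgebra

variable {k : Type*} [NormedField k] [IsUltrametricDist k] {n : ℕ} {ρ : Fin n → PosReal}

/-- The absolute value `|c_J| ρ^J` of the term of degree `J`. -/
def term (f : TateAlgebra k ρ) (J : Fin n →₀ ℕ) : ℝ := ‖coeff J f‖ * weight ρ J

theorem term_nonneg (f : TateAlgebra k ρ) (J : Fin n →₀ ℕ) : 0 ≤ term f J :=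
  mul_nonneg (norm_nonneg _) (weight_pos ρ J).le

theorem term_le (f : TateAlgebra k ρ) (J : Fin n →₀ ℕ) : term f J ≤ ‖f‖ := term_le_norm f J

theorem tendsto_term_cofinite (f : TateAlgebra k ρ) :
    Filter.Tendsto (term f) Filter.cofinite (nhds 0) := tendsto_term f

@[simp] theorem coeff_add (J : Fin n →₀ ℕ) (f g : TateAlgebra k ρ) :
    coeff J (f + g) = coeff J f + coeff J g := by simp [coeff]

@[simp] theorem coeff_sub (J : Fin n →₀ ℕ) (f g : TateAlgebra k ρ) :
    coeff J (f - g) = coeff J f - coeff J g := by simp [coeff]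

@[simp] theorem coeff_zero (J : Fin n →₀ ℕ) : coeff J (0 : TateAlgebra k ρ) = 0 := by
  simp [coeff]

theorem coeff_sum {ι : Type*} (s : Finset ι) (f : ι → TateAlgebra k ρ) (J : Fin n →₀ ℕ) :
    coeff J (∑ i ∈ s, f i) = ∑ i ∈ s, coeff J (f i) := by simp [coeff]

theorem coeff_mul (J : Fin n →₀ ℕ) (f g : TateAlgebra k ρ) :
    coeff J (f * g) =
      ∑ p ∈ Finset.HasAntidiagonal.antidiagonal J, coeff p.1 f * coeff p.2 g := by
  simp only [coeff, map_mul]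
  exact MvPowerSeries.coeff_mul J _ _

theorem norm_le_of_term_le {f : TateAlgebra k ρ} {c : ℝ} (hc : 0 ≤ c) (h : ∀ J, term f J ≤ c) :
    ‖f‖ ≤ c := Real.iSup_le h hc

/-- Strictness survives the supremum because the terms tend to zero. -/
theorem norm_lt_of_term_lt {f : TateAlgebra k ρ} {c : ℝ} (hc : 0 < c) (h : ∀ J, term f J < c) :
    ‖f‖ < c := by
  obtain ⟨ε, hε, hε1, hle⟩ := exists_lt_one_forall_le_mul (tendsto_term_cofinite f) hc Set.univ
    (fun J _ => h J)
  exact (norm_le_of_term_le (by positivity) (fun J => hle J trivial)).trans_lt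
    (mul_lt_of_lt_one_left hc hε1)

theorem term_add_le (f g : TateAlgebra k ρ) (J : Fin n →₀ ℕ) :
    term (f + g) J ≤ max (term f J) (term g J) := by
  simp only [term, coeff_add]
  rw [← max_mul_of_nonneg _ _ (weight_pos ρ J).le]
  exact mul_le_mul_of_nonneg_right (IsUltrametricDist.norm_add_le_max _ _) (weight_pos ρ J).le

theorem term_neg (f : TateAlgebra k ρ) (J : Fin n →₀ ℕ) : term (-f) J = term f J := by
  simp [term, coeff]

theorem term_sub_le (f g : TateAlgebra k ρ) (J : Fin n →₀ ℕ) :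
    term (f - g) J ≤ max (term f J) (term g J) := by
  rw [sub_eq_add_neg, ← term_neg g J]
  exact term_add_le f (-g) J

/-- The monomial `c T^J`. -/
def monomial (J : Fin n →₀ ℕ) (c : k) : TateAlgebra k ρ :=
  ⟨MvPowerSeries.monomial J c, MvPowerSeries.isRestricted_monomial _ _ _⟩

theorem coeff_monomial_mul (J K : Fin n →₀ ℕ) (c : k) (f : TateAlgebra k ρ) :
    coeff K (monomial J c * f) = if J ≤ K then c * coeff (K - J) f else 0 := by
  rw [coeff, map_mul]
  exact MvPowerSeries.coeff_monomial_mul _ _ _ _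

theorem coeff_monomial (J K : Fin n →₀ ℕ) (c : k) :
    coeff K (monomial J c : TateAlgebra k ρ) = if K = J then c else 0 := by
  exact MvPowerSeries.coeff_monomial K J c

theorem term_add_monomial_mul (J K : Fin n →₀ ℕ) (c : k) (f : TateAlgebra k ρ) :
    term (monomial J c * f) (J + K) = ‖c‖ * weight ρ J * term f K := by
  rw [term, coeff_monomial_mul, if_pos le_self_add, add_tsub_cancel_left, norm_mul, weight_add,
    term]
  ring

theorem term_monomial_mul_of_not_le {J K : Fin n →₀ ℕ} (h : ¬ J ≤ K) (c : k)
    (f : TateAlgebra k ρ) : term (monomial J c * f) K = 0 := by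
  rw [term, coeff_monomial_mul, if_neg h, norm_zero, zero_mul]

theorem norm_monomial_mul_le (J : Fin n →₀ ℕ) (c : k) (f : TateAlgebra k ρ) :
    ‖monomial J c * f‖ ≤ ‖c‖ * weight ρ J * ‖f‖ := by
  have h0 : 0 ≤ ‖c‖ * weight ρ J := mul_nonneg (norm_nonneg _) (weight_pos ρ J).le
  refine norm_le_of_term_le (mul_nonneg h0 (norm_nonneg f)) fun K => ?_
  by_cases h : J ≤ K
  · obtain ⟨K, rfl⟩ := exists_add_of_le h
    rw [term_add_monomial_mul]
    exact mul_le_mul_of_nonneg_left (term_le f K) h0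
  · rw [term_monomial_mul_of_not_le h]
    exact mul_nonneg h0 (norm_nonneg f)

/-! ### Completeness -/

theorem norm_coeff_le_div (f : TateAlgebra k ρ) (J : Fin n →₀ ℕ) :
    ‖coeff J f‖ ≤ ‖f‖ / weight ρ J := by
  rw [le_div_iff₀ (weight_pos ρ J)]
  exact term_le f J

theorem lipschitzWith_coeff (J : Fin n →₀ ℕ) : LipschitzWith (⟨(weight ρ J)⁻¹,
    (inv_pos.2 (weight_pos ρ J)).le⟩) (coeff J : TateAlgebra k ρ → k) := by
  refine LipschitzWith.of_dist_le_mul fun f g => ?_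
  rw [dist_eq_norm, dist_eq_norm, ← coeff_sub]
  refine (norm_coeff_le_div _ J).trans_eq ?_
  rw [div_eq_inv_mul]
  rfl

instance [CompleteSpace k] : CompleteSpace (TateAlgebra k ρ) := by
  refine Metric.complete_of_cauchySeq_tendsto fun u hu => ?_
  have hlim : ∀ J, ∃ c : k, Filter.Tendsto (fun m => coeff J (u m)) Filter.atTop (nhds c) :=
    fun J => cauchySeq_tendsto_of_complete ((lipschitzWith_coeff J).uniformContinuous.comp_cauchySeq hu)
  choose c hc using hlim
  -- The Cauchy bound is uniform in `J` and passes to the limit in the second index; it gives both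
  -- restrictedness of the limit series and convergence in the Gauss norm.
  have key : ∀ ε > 0, ∃ N, ∀ m ≥ N, ∀ J, ‖coeff J (u m) - c J‖ * weight ρ J ≤ ε := by
    intro ε hε
    obtain ⟨N, hN⟩ := Metric.cauchySeq_iff.1 hu ε hε
    refine ⟨N, fun m hm J => ?_⟩
    refine le_of_tendsto (((tendsto_const_nhds.sub (hc J)).norm).mul_const _)
      (Filter.eventually_atTop.2 ⟨N, fun l hl => ?_⟩)
    rw [← coeff_sub]
    exact (term_le _ J).trans (dist_eq_norm (u m) (u l) ▸ (hN m hm l hl).le)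
  have hres : MvPowerSeries.IsRestricted (fun i => (ρ i : ℝ))
      (fun J => c J : MvPowerSeries (Fin n) k) := by
    change Filter.Tendsto (fun J => ‖c J‖ * weight ρ J) Filter.cofinite (nhds 0)
    refine Metric.tendsto_nhds.2 fun ε hε => ?_
    obtain ⟨N, hN⟩ := key (ε / 2) (half_pos hε)
    filter_upwards [Metric.tendsto_nhds.1 (tendsto_term_cofinite (u N)) ε hε] with J hJ
    rw [Real.dist_eq, sub_zero, abs_of_nonneg] at hJ ⊢
    · have h1 : ‖c J‖ ≤ max ‖coeff J (u N)‖ ‖coeff J (u N) - c J‖ := by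
        have h := norm_sub_le_max_norm (coeff J (u N)) (coeff J (u N) - c J)
        rwa [sub_sub_cancel] at h
      refine (mul_le_mul_of_nonneg_right h1 (weight_pos ρ J).le).trans_lt ?_
      rw [max_mul_of_nonneg _ _ (weight_pos ρ J).le]
      exact max_lt hJ ((hN N le_rfl J).trans_lt (half_lt_self hε))
    · exact mul_nonneg (norm_nonneg _) (weight_pos ρ J).le
    · exact term_nonneg _ _
  obtain ⟨f, hf⟩ : ∃ f : TateAlgebra k ρ, ∀ J, coeff J f = c J := ⟨⟨_, hres⟩, fun _ => rfl⟩
  refine ⟨f, Metric.tendsto_atTop.2 fun ε hε => ?_⟩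
  obtain ⟨N, hN⟩ := key (ε / 2) (half_pos hε)
  refine ⟨N, fun m hm => (dist_eq_norm _ _).trans_lt ?_⟩
  refine (norm_le_of_term_le (half_pos hε).le fun J => ?_).trans_lt (half_lt_self hε)
  rw [term, coeff_sub, hf]
  exact hN m hm J

/-! ### Leading exponents and division -/

/-- `J` is the largest exponent, for the monomial order `o`, of the terms of maximal absolute
value of the series `f`. -/
def IsLeadingExponent (o : MonomialOrder (Fin n)) (f : TateAlgebra k ρ) (J : Fin n →₀ ℕ) : Prop :=
  term f J = ‖f‖ ∧ ∀ K, o.toSyn J < o.toSyn K → term f K < ‖f‖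

theorem exists_isLeadingExponent (o : MonomialOrder (Fin n)) {f : TateAlgebra k ρ} (hf : f ≠ 0) :
    ∃ J, IsLeadingExponent o f J := by
  have hpos : 0 < ‖f‖ := norm_pos_iff.2 hf
  have hfin : {J | ‖f‖ ≤ term f J}.Finite := by
    have := (tendsto_term_cofinite f).eventually (gt_mem_nhds hpos)
    rw [Filter.eventually_cofinite] at this
    simpa only [not_lt] using this
  have hne : {J | ‖f‖ ≤ term f J}.Nonempty := by
    by_contra h
    rw [Set.not_nonempty_iff_eq_empty, Set.eq_empty_iff_forall_notMem] at h
    exact (norm_lt_of_term_lt hpos fun J => not_le.1 (h J)).false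
  obtain ⟨J, hJ, hmax⟩ := Set.exists_max_image _ o.toSyn hfin hne
  exact ⟨J, (term_le f J).antisymm hJ, fun K hK => not_le.1 fun h => hK.not_ge (hmax K h)⟩

theorem exists_norm_eq_term (f : TateAlgebra k ρ) : ∃ J, ‖f‖ = term f J := by
  by_cases hf : f = 0
  · exact ⟨0, by simp [hf, term]⟩
  · obtain ⟨J, hJ⟩ := exists_isLeadingExponent MonomialOrder.lex hf
    exact ⟨J, hJ.1.symm⟩

variable (o : MonomialOrder (Fin n)) (I : Ideal (TateAlgebra k ρ))

/-- The leading exponents of the nonzero elements of an ideal. -/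
def leadingExponents : Set (Fin n →₀ ℕ) := {J | ∃ f ∈ I, f ≠ 0 ∧ IsLeadingExponent o f J}

/-- Dividing by the leading coefficient normalizes the series. Its terms beyond `J` are strictly
below the norm and tend to zero, so they stay below a fixed proportion of it. -/
theorem exists_monic_of_mem_leadingExponents {J : Fin n →₀ ℕ} (hJ : J ∈ leadingExponents o I) :
    ∃ f ∈ I, coeff J f = 1 ∧ ‖f‖ = weight ρ J ∧ ∃ ε : ℝ, 0 < ε ∧ ε < 1 ∧
      ∀ K, o.toSyn J < o.toSyn K → term f K ≤ ε * weight ρ J := by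
  obtain ⟨f, hfI, hf, hlead, hlt⟩ := hJ
  have hpos : 0 < ‖f‖ := norm_pos_iff.2 hf
  have hc : coeff J f ≠ 0 := by
    intro h
    rw [term, h, norm_zero, zero_mul] at hlead
    exact hpos.ne hlead
  have hterm : ∀ K, term (monomial 0 (coeff J f)⁻¹ * f) K = ‖coeff J f‖⁻¹ * term f K := by
    intro K
    have h := term_add_monomial_mul 0 K (coeff J f)⁻¹ f
    rwa [zero_add, norm_inv, weight, Finsupp.prod_zero_index, mul_one] at h
  have hcoeff : coeff J (monomial 0 (coeff J f)⁻¹ * f) = 1 := by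
    rw [coeff_monomial_mul, if_pos (zero_le), tsub_zero, inv_mul_cancel₀ hc]
  have hJ' : ‖coeff J f‖⁻¹ * ‖f‖ = weight ρ J := by
    rw [← hlead, term, inv_mul_cancel_left₀ (norm_ne_zero_iff.2 hc)]
  have hcpos : 0 < ‖coeff J f‖⁻¹ := inv_pos.2 (norm_pos_iff.2 hc)
  refine ⟨monomial 0 (coeff J f)⁻¹ * f, I.mul_mem_left _ hfI, hcoeff, le_antisymm ?_ ?_, ?_⟩
  · refine norm_le_of_term_le (weight_pos ρ J).le fun K => ?_
    rw [hterm, ← hJ']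
    exact mul_le_mul_of_nonneg_left (term_le f K) hcpos.le
  · have h := term_le (monomial 0 (coeff J f)⁻¹ * f) J
    rwa [term, hcoeff, norm_one, one_mul] at h
  · refine exists_lt_one_forall_le_mul (tendsto_term_cofinite _) (weight_pos ρ J)
      {K | o.toSyn J < o.toSyn K} fun K hK => ?_
    rw [hterm, ← hJ']
    exact mul_lt_mul_of_pos_left (hlt K hK) hcpos

/-- Dickson's lemma: the minimal elements form an antichain in a well-quasi-order. -/
theorem exists_finite_dominating (L : Set (Fin n →₀ ℕ)) :
    ∃ F ⊆ L, F.Finite ∧ ∀ J ∈ L, ∃ K ∈ F, K ≤ J := by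
  refine ⟨{J | Minimal (· ∈ L) J}, fun J hJ => hJ.prop, ?_, fun J hJ => ?_⟩
  · exact (setOfPred_minimal_antichain _).finite_of_partiallyWellOrderedOn
      (Set.isPWO_of_wellQuasiOrderedLE _)
  · obtain ⟨K, hKJ, hK⟩ := exists_minimal_le_of_wellFoundedLT (· ∈ L) J hJ
    exact ⟨K, hK, hKJ⟩

/-- The maximum of the finitely many proportions attached to a dominating set serves every leading
exponent, since a divisor `K ≤ J` suffices to cancel a term at `J`. -/
theorem exists_uniform_monic :
    ∃ ε : ℝ, 0 < ε ∧ ε < 1 ∧ ∀ J ∈ leadingExponents o I, ∃ K ≤ J, ∃ f ∈ I, coeff K f = 1 ∧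
      ‖f‖ = weight ρ K ∧ ∀ M, o.toSyn K < o.toSyn M → term f M ≤ ε * weight ρ K := by
  obtain ⟨F, hFL, hF, hdom⟩ := exists_finite_dominating (leadingExponents o I)
  have h := fun J (hJ : J ∈ F) => exists_monic_of_mem_leadingExponents o I (hFL hJ)
  choose! f hfI hf1 hfn ε hε0 hε1 hε using h
  obtain hne | hne := F.eq_empty_or_nonempty
  · refine ⟨1 / 2, by norm_num, by norm_num, fun J hJ => ?_⟩
    obtain ⟨K, hK, -⟩ := hdom J hJ
    simp [hne] at hK
  · obtain ⟨M, hM, hmax⟩ := Set.exists_max_image F ε hF hne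
    refine ⟨ε M, hε0 M hM, hε1 M hM, fun J hJ => ?_⟩
    obtain ⟨K, hK, hKJ⟩ := hdom J hJ
    exact ⟨K, hKJ, f K, hfI K hK, hf1 K hK, hfn K hK, fun P hP => (hε K hK P hP).trans
      (mul_le_mul_of_nonneg_right (hmax K hK) (weight_pos ρ K).le)⟩

/-- Approximate division by an ideal. -/
theorem exists_division : ∃ ε : ℝ, 0 < ε ∧ ε < 1 ∧ ∀ (f : TateAlgebra k ρ) (c : ℝ), 0 < c →
    ‖f‖ ≤ c → ∃ g ∈ I, ‖g‖ ≤ c ∧ ∀ J ∈ leadingExponents o I, term (f - g) J ≤ ε * c := by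
  obtain ⟨ε, hε0, hε1, hmonic⟩ := exists_uniform_monic o I
  refine ⟨ε, hε0, hε1, fun f c hc hfc => ?_⟩
  have hεc : 0 < ε * c := mul_pos hε0 hc
  -- Well-founded induction on a strict upper bound `s` of the offending exponents, those in the
  -- leading set whose term exceeds `ε * c`. The value `⊤` imposes no condition at the start. The
  -- bound `c` stays fixed while `f` changes.
  suffices H : ∀ (s : WithTop o.syn) (f : TateAlgebra k ρ), ‖f‖ ≤ c →
      (∀ J ∈ leadingExponents o I, ε * c < term f J → (o.toSyn J : WithTop o.syn) < s) →
      ∃ g ∈ I, ‖g‖ ≤ c ∧ ∀ J ∈ leadingExponents o I, term (f - g) J ≤ ε * c from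
    H ⊤ f hfc fun J _ _ => WithTop.coe_lt_top _
  intro s
  induction s using WellFoundedLT.induction with
  | ind s ih =>
  intro f hfc hs
  have hfin : {J | ε * c < term f J}.Finite := by
    have := (tendsto_term_cofinite f).eventually (gt_mem_nhds hεc)
    rw [Filter.eventually_cofinite] at this
    exact this.subset fun J hJ => not_lt.2 (le_of_lt hJ)
  obtain hne | hne := (leadingExponents o I ∩ {J | ε * c < term f J}).eq_empty_or_nonempty
  · refine ⟨0, I.zero_mem, by simpa using hc.le, fun J hJ => ?_⟩
    rw [sub_zero]
    by_contra h
    exact Set.eq_empty_iff_forall_notMem.1 hne J ⟨hJ, not_le.1 h⟩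
  obtain ⟨J, hJ, hmax⟩ := Set.exists_max_image _ o.toSyn
    (hfin.subset Set.inter_subset_right) hne
  obtain ⟨K, hKJ, b, hbI, hb1, hbn, hb⟩ := hmonic J hJ.1
  obtain ⟨P, rfl⟩ := exists_add_of_le hKJ
  rw [add_comm K P] at hJ hmax
  -- This multiple of `b` cancels the largest offending term of `f`; its own terms beyond that
  -- exponent are at most `ε * c`, so the offending exponents of `f - g` are strictly smaller.
  set g := monomial P (coeff (P + K) f) * b with hg
  have hw : ‖coeff (P + K) f‖ * weight ρ P * weight ρ K = term f (P + K) := by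
    rw [term, weight_add, mul_assoc]
  have h0 : 0 ≤ ‖coeff (P + K) f‖ * weight ρ P :=
    mul_nonneg (norm_nonneg _) (weight_pos ρ P).le
  have hgc : ‖g‖ ≤ c := by
    refine (norm_monomial_mul_le _ _ _).trans ?_
    rw [hbn, hw]
    exact (term_le _ _).trans hfc
  have hgt : ∀ M, o.toSyn (P + K) < o.toSyn M → term g M ≤ ε * c := by
    intro M hM
    by_cases hPM : P ≤ M
    · obtain ⟨M, rfl⟩ := exists_add_of_le hPM
      rw [map_add, map_add] at hM
      rw [hg, term_add_monomial_mul]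
      refine (mul_le_mul_of_nonneg_left (hb M (lt_of_add_lt_add_left hM)) h0).trans ?_
      rw [mul_left_comm, hw]
      exact mul_le_mul_of_nonneg_left ((term_le _ _).trans hfc) hε0.le
    · rw [hg, term_monomial_mul_of_not_le hPM]
      exact hεc.le
  obtain ⟨g', hg'I, hg'c, hg'⟩ := ih (o.toSyn (P + K) : WithTop o.syn) (hs _ hJ.1 hJ.2) (f - g)
    ((norm_sub_le_max_norm f g).trans (max_le hfc hgc)) (by
      intro M hM hlt
      rw [WithTop.coe_lt_coe]
      by_contra hle
      -- At the cancelled exponent the term is zero; beyond it, `f` has no offending term by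
      -- maximality and `g` has only small ones.
      obtain heq | hlt' := (not_lt.1 hle).eq_or_lt
      · have := o.toSyn.injective heq
        subst this
        have : term (f - g) (P + K) = 0 := by
          rw [term, coeff_sub, hg, coeff_monomial_mul, if_pos le_self_add, add_tsub_cancel_left,
            hb1, mul_one, sub_self, norm_zero, zero_mul]
        exact (hεc.trans (this ▸ hlt)).false
      · refine hlt.not_ge ((term_sub_le f g M).trans (max_le ?_ (hgt M hlt')))
        by_contra hM'
        exact hlt'.not_ge (hmax M ⟨hM, not_le.1 hM'⟩))
  refine ⟨g + g', I.add_mem (I.mul_mem_left _ hbI) hg'I,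
    (IsUltrametricDist.norm_add_le_max g g').trans (max_le hgc hg'c), fun M hM => ?_⟩
  rw [← sub_sub]
  exact hg' M hM

/-- If the terms of `h` with exponent in the leading exponents of `I` are not maximal, then
`h` is an element of minimal norm in its class modulo `I`. -/
theorem norm_le_norm_sub {h x : TateAlgebra k ρ}
    (hh : ∀ J ∈ leadingExponents o I, term h J < ‖h‖) (hx : x ∈ I) : ‖h‖ ≤ ‖h - x‖ := by
  by_contra! hlt
  have hxn : ‖x‖ = ‖h‖ := by
    rw [sub_eq_add_neg] at hlt
    rw [← norm_neg x]
    exact (IsUltrametricDist.norm_eq_of_add_norm_lt_max (hlt.trans_le (le_max_left _ _))).symm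
  have hx0 : x ≠ 0 := by
    rintro rfl
    simp at hlt
  -- At the leading exponent of `x` its term equals `‖h‖`, yet it is the difference of the terms of
  -- `h` and `h - x`, both smaller.
  obtain ⟨J, hJ⟩ := exists_isLeadingExponent o hx0
  have h1 := hh J ⟨x, hx, hx0, hJ⟩
  have h2 : term x J ≤ max (term h J) (term (h - x) J) := by
    have := term_sub_le h (h - x) J
    rwa [sub_sub_cancel] at this
  rw [hJ.1, hxn] at h2
  exact (h2.trans_lt (max_lt h1 ((term_le _ J).trans_lt hlt))).false

/-- Take a preimage `f` with `ε * ‖f‖ < ‖a‖` and divide it. The remainder has terms at most `ε *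
‖f‖` at the leading exponents, strictly below its own norm, so it is minimal in its class. The room
for such an `f` comes from `‖a‖ ≠ 0`. -/
theorem exists_mk_eq_norm_eq_of_norm_ne_zero {a : TateAlgebra k ρ ⧸ I} (ha : ‖a‖ ≠ 0) :
    ∃ f : TateAlgebra k ρ, Ideal.Quotient.mk I f = a ∧ ‖f‖ = ‖a‖ := by
  obtain ⟨ε, hε0, hε1, hdiv⟩ := exists_division MonomialOrder.lex I
  have hpos : 0 < ‖a‖ := (norm_nonneg a).lt_of_ne' ha
  have hlt : ‖a‖ < ‖a‖ / ε := (lt_div_iff₀ hε0).2 (mul_lt_of_lt_one_right hpos hε1)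
  obtain ⟨f, rfl, hf⟩ := Ideal.Quotient.norm_mk_lt a (sub_pos.2 hlt)
  rw [add_sub_cancel, lt_div_iff₀' hε0] at hf
  have hfpos : 0 < ‖f‖ := hpos.trans_le (Ideal.Quotient.norm_mk_le I f)
  obtain ⟨g, hgI, hgn, hg⟩ := hdiv f ‖f‖ hfpos le_rfl
  have hmk : Ideal.Quotient.mk I (f - g) = Ideal.Quotient.mk I f := by
    rw [map_sub, Ideal.Quotient.eq_zero_iff_mem.2 hgI, sub_zero]
  have hle : ‖Ideal.Quotient.mk I f‖ ≤ ‖f - g‖ := hmk ▸ Ideal.Quotient.norm_mk_le I (f - g)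
  refine ⟨f - g, hmk, hle.antisymm' (le_of_forall_pos_le_add fun δ hδ => ?_)⟩
  obtain ⟨b, hb, hbn⟩ := Ideal.Quotient.norm_mk_lt (Ideal.Quotient.mk I f) hδ
  refine (norm_le_norm_sub MonomialOrder.lex I (x := f - g - b)
    (fun J hJ => (hg J hJ).trans_lt (hf.trans_le hle)) ?_).trans ?_
  · rw [← Ideal.Quotient.eq_zero_iff_mem, map_sub, hmk, hb, sub_self]
  · rw [sub_sub_cancel]
    exact hbn.le

/-! ### Closedness of the ideal and optimal preimages -/

theorem isClosed_of_isStronglyGenerating [CompleteSpace k] {m : ℕ} (a : Fin m → I)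
    (ha : IsStronglyGenerating (TateAlgebra k ρ) a) : IsClosed (I : Set (TateAlgebra k ρ)) := by
  have hpos : ∀ i, 0 < ‖(a i : TateAlgebra k ρ)‖ := fun i =>
    norm_pos_iff.2 fun h => ha.1 i (Subtype.ext h)
  let Φ : NormedAddGroupHom (Fin m → TateAlgebra k ρ) (TateAlgebra k ρ) :=
    AddMonoidHom.mkNormedAddGroupHom
      (AddMonoidHom.mk' (fun b => ∑ i, b i * (a i : TateAlgebra k ρ))
        (fun b c => by simp [add_mul, Finset.sum_add_distrib]))
      (∑ i, ‖(a i : TateAlgebra k ρ)‖) (fun b => by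
        rw [Finset.sum_mul]
        refine (norm_sum_le Finset.univ
          (fun i => b i * (a i : TateAlgebra k ρ))).trans (Finset.sum_le_sum fun i _ => ?_)
        exact (norm_mul_le _ _).trans (le_of_eq_of_le (mul_comm _ _)
          (mul_le_mul_of_nonneg_left (norm_le_pi_norm b i) (norm_nonneg _))))
  have hΦ : ∀ b, Φ b = ∑ i, b i * (a i : TateAlgebra k ρ) := fun b => rfl
  -- The sum dominates each `‖a i‖⁻¹`, hence the norms of the coefficients given by strong
  -- generation; the `1` keeps `C` positive for an empty family.
  set C : ℝ := 1 + ∑ i, ‖(a i : TateAlgebra k ρ)‖⁻¹ with hC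
  have hC0 : 0 < C :=
    add_pos_of_pos_of_nonneg one_pos (Finset.sum_nonneg fun i _ => inv_nonneg.2 (norm_nonneg _))
  have hsurj : Φ.SurjectiveOnWith I.toAddSubgroup C := by
    intro x hx
    obtain ⟨b, hb, hbn⟩ := ha.2 ⟨x, hx⟩
    refine ⟨b, ?_, (pi_norm_le_iff_of_nonneg (by positivity)).2 fun i => ?_⟩
    · rw [hΦ]
      simpa using (congrArg Subtype.val hb).symm
    · have h1 : ‖b i‖ * ‖(a i : TateAlgebra k ρ)‖ ≤ ‖x‖ := by
        have h2 : ‖x‖ = ⨆ i, ‖b i‖ * ‖a i‖ := hbn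
        rw [h2]
        exact le_ciSup (f := fun i => ‖b i‖ * ‖a i‖) (Set.finite_range _).bddAbove i
      rw [← le_div_iff₀ (hpos i), div_eq_inv_mul] at h1
      refine h1.trans (mul_le_mul_of_nonneg_right ?_ (norm_nonneg x))
      have := Finset.single_le_sum (f := fun i => ‖(a i : TateAlgebra k ρ)‖⁻¹)
        (fun i _ => inv_nonneg.2 (norm_nonneg _)) (Finset.mem_univ i)
      linarith
  refine isClosed_of_closure_subset fun x hx => ?_
  obtain ⟨b, rfl, -⟩ := controlled_closure_of_complete hC0 one_pos hsurj x hx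
  rw [hΦ]
  exact I.sum_mem fun i _ => I.mul_mem_left _ (a i).2

-- A class of norm zero lies in the closure of `I`, hence is zero and is lifted by `0`.
theorem exists_mk_eq_norm_eq (hI : IsClosed (I : Set (TateAlgebra k ρ)))
    (a : TateAlgebra k ρ ⧸ I) :
    ∃ f : TateAlgebra k ρ, Ideal.Quotient.mk I f = a ∧ ‖f‖ = ‖a‖ := by
  by_cases ha : ‖a‖ = 0
  · obtain ⟨f, rfl⟩ := Ideal.Quotient.mk_surjective a
    have hf : f ∈ closure (I.toAddSubgroup : Set (TateAlgebra k ρ)) :=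
      QuotientAddGroup.norm_mk_eq_zero_iff_mem_closure.1 ha
    have hfI : f ∈ I := hI.closure_subset hf
    exact ⟨0, by rw [map_zero, Ideal.Quotient.eq_zero_iff_mem.2 hfI], by rw [norm_zero, ha]⟩
  · exact exists_mk_eq_norm_eq_of_norm_ne_zero I ha

end TateAlgebra

/-! ### Calculus of symbols in residue rings -/

namespace ResidueRing

variable {Γ : Subgroup PosReal} {A : Type*} [CommRing A] {ν : UltraSeminorm A}

theorem symbol_congr {γ δ : Γ} {a b : A} (hγ : γ = δ) (hab : a = b) (ha : ν a ≤ (γ : PosReal))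
    (hb : ν b ≤ (δ : PosReal)) : symbol ν γ a ha = symbol ν δ b hb := by
  subst hγ hab
  rfl

theorem symbol_add {γ : Γ} {a b : A} (ha : ν a ≤ (γ : PosReal)) (hb : ν b ≤ (γ : PosReal))
    (hab : ν (a + b) ≤ (γ : PosReal)) :
    symbol ν γ (a + b) hab = symbol ν γ a ha + symbol ν γ b hb := by
  rw [symbol, symbol, symbol, ← map_add, ← map_add]
  rfl

theorem symbol_eq_zero_iff {γ : Γ} {a : A} (ha : ν a ≤ (γ : PosReal)) :
    symbol ν γ a ha = 0 ↔ ν a < (γ : PosReal) := by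
  rw [symbol, ← map_zero (DirectSum.of (GradedPiece Γ ν) (Additive.ofMul γ)),
    (DirectSum.of_injective _).eq_iff]
  exact GradedPiece.mk_eq_zero_iff _ _

theorem symbol_mul {γ δ : Γ} {a b : A} (ha : ν a ≤ (γ : PosReal)) (hb : ν b ≤ (δ : PosReal))
    (hab : ν (a * b) ≤ ((γ * δ : Γ) : PosReal)) :
    symbol ν γ a ha * symbol ν δ b hb = symbol ν (γ * δ) (a * b) hab :=
  DirectSum.of_mul_of _ _

theorem symbol_one (h : ν 1 ≤ ((1 : Γ) : PosReal)) : symbol ν (1 : Γ) 1 h = 1 := rfl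

theorem seminorm_mul_le {γ δ : Γ} {a b : A} (ha : ν a ≤ (γ : PosReal))
    (hb : ν b ≤ (δ : PosReal)) : ν (a * b) ≤ ((γ * δ : Γ) : PosReal) :=
  GradedPiece.mul_mem (γ := Additive.ofMul γ) (δ := Additive.ofMul δ) ha hb

theorem symbol_pow {γ : Γ} {a : A} (ha : ν a ≤ (γ : PosReal)) (m : ℕ) :
    ∃ h : ν (a ^ m) ≤ ((γ ^ m : Γ) : PosReal), symbol ν γ a ha ^ m = symbol ν (γ ^ m) (a ^ m) h := by
  induction m with
  | zero =>
    have h : ν 1 ≤ ((1 : Γ) : PosReal) := ν.one_le'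
    refine ⟨by simpa using h, ?_⟩
    rw [pow_zero, ← symbol_one h]
    exact symbol_congr (pow_zero γ).symm (pow_zero a).symm _ _
  | succ m ih =>
    obtain ⟨h, ih⟩ := ih
    have h' := seminorm_mul_le h ha
    refine ⟨by rwa [pow_succ, pow_succ], ?_⟩
    rw [pow_succ, ih, symbol_mul h ha h']
    exact symbol_congr (pow_succ γ m).symm (pow_succ a m).symm _ _

theorem mem_degree_iff {γ : Γ} {x : ResidueRing Γ ν} :
    x ∈ degree ν γ ↔ ∃ a h, x = symbol ν γ a h := by
  constructor
  · rintro ⟨y, rfl⟩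
    obtain ⟨⟨a, ha⟩, rfl⟩ := GradedPiece.mk_surjective _ y
    exact ⟨a, ha, rfl⟩
  · rintro ⟨a, h, rfl⟩
    exact ⟨_, rfl⟩

theorem symbol_mem_degree {γ : Γ} {a : A} (h : ν a ≤ (γ : PosReal)) :
    symbol ν γ a h ∈ degree ν γ := mem_degree_iff.2 ⟨a, h, rfl⟩

theorem symbol_sum {ι : Type*} (s : Finset ι) {γ : Γ} {a : ι → A}
    (ha : ∀ i, ν (a i) ≤ (γ : PosReal)) : ∃ h : ν (∑ i ∈ s, a i) ≤ (γ : PosReal),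
      symbol ν γ (∑ i ∈ s, a i) h = ∑ i ∈ s, symbol ν γ (a i) (ha i) := by
  classical
  induction s using Finset.induction_on with
  | empty =>
    have h : ν 0 < (γ : PosReal) := by rw [ν.map_zero]; exact γ.1.2
    exact ⟨by simpa using h.le, by simpa using (symbol_eq_zero_iff h.le).2 h⟩
  | insert i s hi ih =>
    obtain ⟨h, ih⟩ := ih
    simp only [Finset.sum_insert hi]
    exact ⟨(ν.nonarch' _ _).trans (max_le (ha i) h), by rw [symbol_add (ha i) h, ih]⟩

theorem eq_zero_of_sum_eq_zero_of_mem_degree {s : Finset Γ} {x : Γ → ResidueRing Γ ν}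
    (hx : ∀ γ, x γ ∈ degree ν γ) (hsum : ∑ γ ∈ s, x γ = 0) : ∀ γ ∈ s, x γ = 0 := by
  intro γ hγ
  choose y hy using hx
  have h := congrArg (fun z : ResidueRing Γ ν => z (Additive.ofMul γ)) hsum
  simp only [← hy] at h ⊢
  rw [DirectSum.sum_apply, Finset.sum_eq_single γ (fun δ _ hδ => DirectSum.of_eq_of_ne _ _ _
    (fun h => hδ (Additive.ofMul.injective h).symm)) (fun h => absurd hγ h),
    DirectSum.of_eq_same] at h
  rw [h]
  exact map_zero _

/-- If the `m`-th power of a symbol vanishes, then `ν a ^ m < γ ^ m`, so the symbol itself vanishes.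
-/
theorem isGradedReduced_of_isPowMul (hν : ∀ a : A, ∀ m, 1 ≤ m → ν (a ^ m) = ν a ^ m) :
    IsGradedReduced (ResidueRing Γ ν) (degree ν) := by
  intro γ x hx ⟨m, hm⟩
  obtain ⟨a, h, rfl⟩ := mem_degree_iff.1 hx
  -- Exponent zero means `1 = 0` in the residue ring.
  obtain rfl | hm0 := Nat.eq_zero_or_pos m
  · rw [pow_zero] at hm
    rw [← one_mul (symbol _ _ _ _), hm, zero_mul]
  obtain ⟨h', he⟩ := symbol_pow h m
  rw [he, symbol_eq_zero_iff, hν a m hm0] at hm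
  rw [symbol_eq_zero_iff]
  refine lt_of_pow_lt_pow_left₀ m γ.1.2.le (hm.trans_eq ?_)
  simp

end ResidueRing

theorem IsGradedIso.isGradedReduced {Γ R S : Type*} [CommRing R] [CommRing S]
    {𝒜 : Γ → AddSubgroup R} {ℬ : Γ → AddSubgroup S} {f : R →+* S} (hf : IsGradedIso R S 𝒜 ℬ f)
    (h : IsGradedReduced S ℬ) : IsGradedReduced R 𝒜 := by
  intro γ x hx hnil
  refine (map_eq_zero_iff f hf.1.1).1 (h γ (f x) ?_ (hnil.map f))
  rw [← hf.2 γ]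
  exact ⟨x, hx, rfl⟩

theorem IsGradedIso.isGradedReduced_target {Γ R S : Type*} [CommRing R] [CommRing S]
    {𝒜 : Γ → AddSubgroup R} {ℬ : Γ → AddSubgroup S} {f : R →+* S} (hf : IsGradedIso R S 𝒜 ℬ f)
    (h : IsGradedReduced R 𝒜) : IsGradedReduced S ℬ := by
  intro γ y hy hnil
  rw [← hf.2 γ] at hy
  obtain ⟨x, hx, rfl⟩ := hy
  have hx' : IsNilpotent x := (IsNilpotent.map_iff hf.1.1).1 hnil
  rw [h γ x hx hx']
  exact map_zero f

/-! ### Reduction of restricted series to graded polynomials -/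

section Reduction

open ResidueRing

variable {k : Type*} [NormedField k] [IsUltrametricDist k] {Γ : Subgroup PosReal} {n : ℕ}
  {r : Fin n → Γ}

theorem coe_radiusPow_eq_weight (J : Fin n →₀ ℕ) :
    ((radiusPow r J : PosReal) : ℝ) = weight (fun i => (r i : PosReal)) J := coe_radiusPow r J

theorem radiusPow_add (J K : Fin n →₀ ℕ) :
    radiusPow r (J + K) = radiusPow r J * radiusPow r K :=
  Finsupp.prod_add_index' (by simp) (by simp [pow_add])

/-- The terms left out of the finite sum have zero class in degree `γ`, so the formula holds for
every `J` and identities can be checked coefficientwise. -/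
theorem coeff_polySymbol {γ : Γ} {f : Tate k r} (h : ‖f‖ ≤ (γ : PosReal)) (J : Fin n →₀ ℕ) :
    (polySymbol γ f h).coeff J = symbol (fieldNorm k) (γ * (radiusPow r J)⁻¹)
      (TateAlgebra.coeff J f) (norm_coeff_le h J) := by
  classical
  rw [polySymbol, MvPolynomial.coeff_sum]
  simp only [MvPolynomial.coeff_monomial]
  rw [Finset.sum_ite_eq' _ J]
  split_ifs with hJ
  · rfl
  · symm
    rw [symbol_eq_zero_iff]
    simp only [Set.Finite.mem_toFinset, Set.mem_ofPred_eq, not_le] at hJ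
    rw [← coe_radiusPow] at hJ
    change ‖TateAlgebra.coeff J f‖ < ((γ : PosReal) : ℝ) * ((radiusPow r J : PosReal) : ℝ)⁻¹
    rwa [← div_eq_mul_inv, lt_div_iff₀ (radiusPow r J).1.2]

theorem polySymbol_mem_polyDegree {γ : Γ} {f : Tate k r} (h : ‖f‖ ≤ (γ : PosReal)) :
    polySymbol γ f h ∈ polyDegree k r γ := fun J => by
  rw [coeff_polySymbol]
  exact symbol_mem_degree _

theorem polySymbol_congr {γ δ : Γ} {f g : Tate k r} (hγ : γ = δ) (hfg : f = g)
    (hf : ‖f‖ ≤ (γ : PosReal)) (hg : ‖g‖ ≤ (δ : PosReal)) :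
    polySymbol γ f hf = polySymbol δ g hg := by
  subst hγ hfg
  rfl

theorem polySymbol_eq_zero {γ : Γ} {f : Tate k r} (hf : ‖f‖ < (γ : PosReal)) :
    polySymbol γ f hf.le = 0 := by
  refine Finset.sum_eq_zero fun J hJ => ?_
  simp only [Set.Finite.mem_toFinset, Set.mem_ofPred_eq] at hJ
  exact absurd hf (not_lt.2 (hJ.trans (TateAlgebra.term_le_norm f J)))

theorem polySymbol_add {γ : Γ} {f g : Tate k r} (hf : ‖f‖ ≤ (γ : PosReal))
    (hg : ‖g‖ ≤ (γ : PosReal)) (hfg : ‖f + g‖ ≤ (γ : PosReal)) :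
    polySymbol γ (f + g) hfg = polySymbol γ f hf + polySymbol γ g hg := by
  ext1 J
  rw [MvPolynomial.coeff_add, coeff_polySymbol, coeff_polySymbol, coeff_polySymbol,
    ← symbol_add (norm_coeff_le hf J) (norm_coeff_le hg J)]
  · exact symbol_congr rfl (TateAlgebra.coeff_add J f g) _ _
  · rw [← TateAlgebra.coeff_add]
    exact norm_coeff_le hfg J

theorem norm_mul_le_coe {γ δ : Γ} {f g : Tate k r} (hf : ‖f‖ ≤ (γ : PosReal))
    (hg : ‖g‖ ≤ (δ : PosReal)) : ‖f * g‖ ≤ ((γ * δ : Γ) : PosReal) :=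
  (norm_mul_le f g).trans (mul_le_mul hf hg (norm_nonneg g) γ.1.2.le)

theorem polySymbol_mul {γ δ : Γ} {f g : Tate k r} (hf : ‖f‖ ≤ (γ : PosReal))
    (hg : ‖g‖ ≤ (δ : PosReal)) (hfg : ‖f * g‖ ≤ ((γ * δ : Γ) : PosReal)) :
    polySymbol γ f hf * polySymbol δ g hg = polySymbol (γ * δ) (f * g) hfg := by
  classical
  ext1 J
  have hdeg : ∀ p ∈ Finset.HasAntidiagonal.antidiagonal J,
      γ * (radiusPow r p.1)⁻¹ * (δ * (radiusPow r p.2)⁻¹) = γ * δ * (radiusPow r J)⁻¹ := by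
    intro p hp
    rw [← Finset.HasAntidiagonal.mem_antidiagonal.1 hp, radiusPow_add, mul_inv]
    exact mul_mul_mul_comm _ _ _ _
  -- The subtype is used because the degrees agree only on the antidiagonal, while `symbol_sum`
  -- wants a bound for every index.
  have hle : ∀ p : {p // p ∈ Finset.HasAntidiagonal.antidiagonal J},
      fieldNorm k (TateAlgebra.coeff p.1.1 f * TateAlgebra.coeff p.1.2 g) ≤
        ((γ * δ * (radiusPow r J)⁻¹ : Γ) : PosReal) := fun p => by
    rw [← hdeg p.1 p.2]
    exact seminorm_mul_le (norm_coeff_le hf _) (norm_coeff_le hg _)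
  obtain ⟨h, hs⟩ := symbol_sum Finset.univ hle
  rw [MvPolynomial.coeff_mul, coeff_polySymbol, ← Finset.sum_coe_sort]
  refine Eq.trans (Finset.sum_congr rfl fun p _ => ?_) (hs.symm.trans (symbol_congr rfl ?_ _ _))
  · rw [coeff_polySymbol, coeff_polySymbol, symbol_mul _ _
      (seminorm_mul_le (norm_coeff_le hf _) (norm_coeff_le hg _))]
    exact symbol_congr (hdeg p.1 p.2) rfl _ _
  · rw [TateAlgebra.coeff_mul]
    exact Finset.sum_coe_sort (Finset.HasAntidiagonal.antidiagonal J)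
      (fun p => TateAlgebra.coeff p.1 f * TateAlgebra.coeff p.2 g)

theorem polySymbol_sum_mem {ι : Type*} (s : Finset ι) {γ : Γ} {f : ι → Tate k r}
    {J : Ideal (MvPolynomial (Fin n) (ResidueField k Γ))}
    (hf : ∀ i, ∃ h : ‖f i‖ ≤ (γ : PosReal), polySymbol γ (f i) h ∈ J) :
    ∃ h : ‖∑ i ∈ s, f i‖ ≤ (γ : PosReal), polySymbol γ (∑ i ∈ s, f i) h ∈ J := by
  classical
  induction s using Finset.induction_on with
  | empty =>
    have h : ‖(0 : Tate k r)‖ < (γ : PosReal) := by rw [norm_zero]; exact γ.1.2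
    exact ⟨by simpa using h.le, by simpa using polySymbol_eq_zero h ▸ J.zero_mem⟩
  | insert i s hi ih =>
    obtain ⟨h, ih⟩ := ih
    obtain ⟨h', hi'⟩ := hf i
    simp only [Finset.sum_insert hi]
    refine ⟨(IsUltrametricDist.norm_add_le_max _ _).trans (max_le h' h), ?_⟩
    rw [polySymbol_add h' h]
    exact J.add_mem hi' ih

/-- Coefficients are lifted one at a time, with `0` off the support, so that the lift is a finite
sum of monomials. -/
theorem exists_eq_polySymbol {γ : Γ} {p : MvPolynomial (Fin n) (ResidueField k Γ)}
    (hp : p ∈ polyDegree k r γ) :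
    ∃ (f : Tate k r) (h : ‖f‖ ≤ (γ : PosReal)), p = polySymbol γ f h := by
  classical
  choose c hc hpc using fun J => mem_degree_iff.1 (hp J)
  set f : Tate k r := ∑ J ∈ p.support, TateAlgebra.monomial J (c J) with hf
  have hcoeff : ∀ J, TateAlgebra.coeff J f = if J ∈ p.support then c J else 0 := by
    intro J
    rw [hf, TateAlgebra.coeff_sum]
    simp only [TateAlgebra.coeff_monomial]
    rw [Finset.sum_ite_eq]
  have hfn : ‖f‖ ≤ (γ : PosReal) := by
    refine TateAlgebra.norm_le_of_term_le γ.1.2.le fun J => ?_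
    rw [TateAlgebra.term, hcoeff]
    split_ifs
    · rw [← coe_radiusPow_eq_weight, ← le_div_iff₀ (radiusPow r J).1.2, div_eq_mul_inv]
      exact hc J
    · rw [norm_zero, zero_mul]
      exact γ.1.2.le
  refine ⟨f, hfn, ?_⟩
  ext1 J
  rw [coeff_polySymbol]
  by_cases hJ : J ∈ p.support
  · rw [hpc J]
    exact symbol_congr rfl (by rw [hcoeff, if_pos hJ]) _ _
  · rw [MvPolynomial.notMem_support_iff.1 hJ, eq_comm, symbol_eq_zero_iff, hcoeff, if_neg hJ,
      UltraSeminorm.map_zero]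
    exact (γ * (radiusPow r J)⁻¹).1.2

theorem monomial_mem_polyDegree (J : Fin n →₀ ℕ) {δ : Γ} {c : ResidueField k Γ}
    (hc : c ∈ degree (fieldNorm k) δ) :
    MvPolynomial.monomial J c ∈ polyDegree k r (δ * radiusPow r J) := by
  classical
  intro K
  rw [MvPolynomial.coeff_monomial]
  split_ifs with h
  · subst h
    rwa [mul_inv_cancel_right]
  · exact zero_mem _

theorem iSup_polyDegree : ⨆ γ, polyDegree k r γ = ⊤ := by
  rw [eq_top_iff]
  rintro p -
  rw [p.as_sum]
  refine AddSubgroup.sum_mem _ fun J _ => ?_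
  induction p.coeff J using DirectSum.induction_on with
  | zero => rw [map_zero]; exact zero_mem _
  | of γ x =>
    exact AddSubgroup.mem_iSup_of_mem _ (monomial_mem_polyDegree J (δ := γ.toMul) ⟨x, rfl⟩)
  | add x y hx hy => rw [map_add]; exact add_mem hx hy

/-- Existence is enough: the independence of the degrees is used only in the residue ring, a direct
sum by construction. -/
theorem exists_homogeneous_decomposition (r : Fin n → Γ)
    (p : MvPolynomial (Fin n) (ResidueField k Γ)) :
    ∃ (s : Finset Γ) (q : Γ → MvPolynomial (Fin n) (ResidueField k Γ)),
      (∀ γ, q γ ∈ polyDegree k r γ) ∧ p = ∑ γ ∈ s, q γ := by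
  have hp : p ∈ ⨆ γ, polyDegree k r γ := by rw [iSup_polyDegree]; trivial
  classical
  induction hp using AddSubgroup.iSup_induction' with
  | hp γ x hx =>
    refine ⟨{γ}, fun δ => if δ = γ then x else 0, fun δ => ?_, by simp⟩
    dsimp only
    split_ifs with h
    · exact h ▸ hx
    · exact zero_mem _
  | h1 => exact ⟨∅, 0, fun _ => zero_mem _, by simp⟩
  | hadd x y _ _ hx hy =>
    obtain ⟨s, q, hq, rfl⟩ := hx
    obtain ⟨t, q', hq', rfl⟩ := hy
    refine ⟨s ∪ t, fun γ => (if γ ∈ s then q γ else 0) + if γ ∈ t then q' γ else 0, fun γ => ?_, ?_⟩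
    · refine add_mem ?_ ?_ <;> split_ifs <;> first | exact hq γ | exact hq' γ | exact zero_mem _
    · rw [Finset.sum_add_distrib, Finset.sum_ite_mem, Finset.sum_ite_mem,
        Finset.inter_eq_right.2 Finset.subset_union_left,
        Finset.inter_eq_right.2 Finset.subset_union_right]

end Reduction

theorem TateAlgebra.monomial_eq {k : Type*} [NormedField k] [IsUltrametricDist k] {n : ℕ}
    {ρ : Fin n → PosReal} (J : Fin n →₀ ℕ) (c : k) :
    (monomial J c : TateAlgebra k ρ) = C c * ∏ i ∈ J.support, X i ^ J i := by
  apply toPowerSeries_injective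
  rw [map_mul, map_prod]
  have h := congrArg MvPolynomial.coeToMvPowerSeries.ringHom
    (MvPolynomial.monomial_eq (s := J) (a := c))
  rw [map_mul, Finsupp.prod, map_prod] at h
  simp only [map_pow, MvPolynomial.coeToMvPowerSeries.ringHom_apply, MvPolynomial.coe_monomial,
    MvPolynomial.coe_C, MvPolynomial.coe_X] at h
  refine Eq.trans h ?_
  congr 1

theorem ResidueRing.symbol_prod_pow {Γ : Subgroup PosReal} {A : Type*} [CommRing A]
    {ν : UltraSeminorm A} {ι : Type*} (s : Finset ι) {γ : ι → Γ} {a : ι → A}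
    (ha : ∀ i, ν (a i) ≤ (γ i : PosReal)) (e : ι → ℕ) :
    ∃ h : ν (∏ i ∈ s, a i ^ e i) ≤ ((∏ i ∈ s, γ i ^ e i : Γ) : PosReal),
      ∏ i ∈ s, symbol ν (γ i) (a i) (ha i) ^ e i =
        symbol ν (∏ i ∈ s, γ i ^ e i) (∏ i ∈ s, a i ^ e i) h := by
  classical
  induction s using Finset.induction_on with
  | empty => exact ⟨by simpa using ν.one_le', rfl⟩
  | insert i s hi ih =>
    obtain ⟨h, ih⟩ := ih
    obtain ⟨h', hp⟩ := symbol_pow (ha i) (e i)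
    simp only [Finset.prod_insert hi]
    exact ⟨seminorm_mul_le h' h, by rw [ih, hp]; exact symbol_mul h' h _⟩

/-! ### The reduction homomorphism on symbols -/

section Reduction

open ResidueRing

variable {k : Type*} [NormedField k] [IsUltrametricDist k] {Γ : Subgroup PosReal} {n : ℕ}
  {r : Fin n → Γ}

theorem norm_monomial_coeff_le {γ : Γ} {f : Tate k r} (h : ‖f‖ ≤ (γ : PosReal))
    (J : Fin n →₀ ℕ) :
    ‖(TateAlgebra.monomial J (TateAlgebra.coeff J f) : Tate k r)‖ ≤ (γ : PosReal) := by
  refine TateAlgebra.norm_le_of_term_le γ.1.2.le fun K => ?_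
  rw [TateAlgebra.term, TateAlgebra.coeff_monomial]
  split_ifs with hK
  · subst hK
    exact (TateAlgebra.term_le f K).trans h
  · rw [norm_zero, zero_mul]
    exact γ.1.2.le

theorem norm_sub_leading_lt {γ : Γ} (f : Tate k r) :
    ‖f - ∑ J ∈ (finite_leading f γ).toFinset,
      (TateAlgebra.monomial J (TateAlgebra.coeff J f) : Tate k r)‖ < (γ : PosReal) := by
  refine TateAlgebra.norm_lt_of_term_lt γ.1.2 fun J => ?_
  rw [TateAlgebra.term, TateAlgebra.coeff_sub, TateAlgebra.coeff_sum]
  simp only [TateAlgebra.coeff_monomial]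
  rw [Finset.sum_ite_eq]
  split_ifs with hJ
  · rw [sub_self, norm_zero, zero_mul]
    exact γ.1.2
  · simp only [Set.Finite.mem_toFinset, Set.mem_ofPred_eq, not_le] at hJ
    rwa [sub_zero]

variable {A : Type*} [CommRing A] {ν : UltraSeminorm A} {φ : Tate k r →+* A}
  (hφ : ∀ f, ν (φ f) ≤ ‖f‖)

theorem reductionHom_monomial_symbol {γ : Γ} {J : Fin n →₀ ℕ} {c : k}
    (hc : fieldNorm k c ≤ ((γ * (radiusPow r J)⁻¹ : Γ) : PosReal))
    (h : ν (φ (TateAlgebra.monomial J c)) ≤ (γ : PosReal)) :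
    reductionHom ν φ hφ (MvPolynomial.monomial J (symbol (fieldNorm k) _ c hc)) =
      symbol ν γ (φ (TateAlgebra.monomial J c)) h := by
  obtain ⟨h', hX⟩ := symbol_prod_pow J.support
    (fun i => (hφ (TateAlgebra.X i)).trans (TateAlgebra.norm_X_le i)) J
  have hC : ν ((φ.comp TateAlgebra.C) c) ≤ ((γ * (radiusPow r J)⁻¹ : Γ) : PosReal) :=
    ((hφ _).trans (TateAlgebra.norm_C_le c)).trans hc
  rw [reductionHom, MvPolynomial.coe_eval₂Hom, MvPolynomial.eval₂_monomial, map_symbol,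
    Finsupp.prod, hX]
  refine (symbol_mul hC h' (seminorm_mul_le hC h')).trans
    (symbol_congr (inv_mul_cancel_right γ (radiusPow r J)) ?_ _ _)
  rw [TateAlgebra.monomial_eq, map_mul, map_prod]
  simp only [map_pow]
  rfl

/-- Monomials are handled by multiplicativity of symbols. The series differs from the finite sum of
its leading monomials by an element of norm `< γ`, which is invisible in degree `γ`. -/
theorem reductionHom_polySymbol {γ : Γ} {f : Tate k r} (h : ‖f‖ ≤ (γ : PosReal)) :
    reductionHom ν φ hφ (polySymbol γ f h) = symbol ν γ (φ f) ((hφ f).trans h) := by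
  have hle := fun J : Fin n →₀ ℕ => (hφ _).trans (norm_monomial_coeff_le h J)
  obtain ⟨hs, hsum⟩ := symbol_sum (finite_leading f γ).toFinset hle
  rw [polySymbol, map_sum, Finset.sum_congr rfl fun J _ =>
    reductionHom_monomial_symbol hφ (norm_coeff_le h J) (hle J), ← hsum]
  have hlt := (hφ _).trans_lt (norm_sub_leading_lt (γ := γ) f)
  rw [map_sub, map_sum] at hlt
  rw [← zero_add (symbol ν γ _ hs), ← (symbol_eq_zero_iff hlt.le).2 hlt,
    ← symbol_add hlt.le hs (by rw [sub_add_cancel]; exact (hφ f).trans h)]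
  exact symbol_congr rfl (sub_add_cancel _ _) _ _

end Reduction

/-! ### The residue ring of the quotient norm -/

section Quotient

open ResidueRing

variable {k : Type*} [NormedField k] [IsUltrametricDist k] {Γ : Subgroup PosReal} {n m : ℕ}
  {r : Fin n → Γ} {I : Ideal (Tate k r)}

theorem quotientNorm_apply (x : Tate k r ⧸ I) : quotientNorm I x = ‖x‖ := rfl

/-- The norm of an optimal preimage is attained by one of its terms. -/
theorem quotientNorm_eq_norm_mul (hI : IsClosed (I : Set (Tate k r))) (x : Tate k r ⧸ I) :
    ∃ (c : k) (γ : Γ), quotientNorm I x = ‖c‖ * ((γ : PosReal) : ℝ) := by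
  obtain ⟨f, -, hf⟩ := TateAlgebra.exists_mk_eq_norm_eq I hI x
  obtain ⟨J, hJ⟩ := TateAlgebra.exists_norm_eq_term f
  refine ⟨TateAlgebra.coeff J f, radiusPow r J, ?_⟩
  rw [coe_radiusPow_eq_weight, quotientNorm_apply, ← hf, hJ, TateAlgebra.term]

/-- Strong generation provides `x = ∑ b i * a i` with no cancellation of norms, so `b i` has a
symbol in degree `γ / d i` and the symbol of `x` is the sum of the products of symbols. -/
theorem polySymbol_mem_reductionIdeal {a : Fin m → I}
    (ha : IsStronglyGenerating (Tate k r) a) {d : Fin m → Γ}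
    (hd : ∀ i, ‖(a i : Tate k r)‖ = (d i : PosReal)) {γ : Γ} {x : Tate k r} (hx : x ∈ I)
    (hxγ : ‖x‖ ≤ (γ : PosReal)) :
    polySymbol γ x hxγ ∈ reductionIdeal (fun i => (a i : Tate k r)) d hd := by
  obtain ⟨b, hb, hbn⟩ := ha.2 ⟨x, hx⟩
  have hsum : x = ∑ i, b i * (a i : Tate k r) := by
    simpa using congrArg Subtype.val hb
  have hbi : ∀ i, ‖b i‖ ≤ ((γ * (d i)⁻¹ : Γ) : PosReal) := by
    intro i
    have h1 : ‖b i‖ * ‖(a i : Tate k r)‖ ≤ ‖x‖ := by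
      have h2 : ‖x‖ = ⨆ i, ‖b i‖ * ‖a i‖ := hbn
      rw [h2]
      exact le_ciSup (f := fun i => ‖b i‖ * ‖a i‖) (Set.finite_range _).bddAbove i
    have h2 := h1.trans hxγ
    rw [hd, ← le_div_iff₀ (d i).1.2, div_eq_mul_inv] at h2
    exact h2
  obtain ⟨h, hmem⟩ := polySymbol_sum_mem Finset.univ (γ := γ) (f := fun i => b i * (a i : Tate k r))
    (J := reductionIdeal (fun i => (a i : Tate k r)) d hd) (fun i => by
      have hle := norm_mul_le_coe (hbi i) (hd i).le
      have hγ : γ * (d i)⁻¹ * d i = γ := inv_mul_cancel_right γ (d i)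
      refine ⟨hγ ▸ hle, ?_⟩
      rw [← polySymbol_congr hγ rfl hle, ← polySymbol_mul (hbi i) (hd i).le]
      exact Ideal.mul_mem_left _ _ (Ideal.subset_span ⟨i, rfl⟩))
  rwa [polySymbol_congr rfl hsum hxγ h]

theorem inducesIso_quotientNorm (hI : IsClosed (I : Set (Tate k r))) {a : Fin m → I}
    (ha : IsStronglyGenerating (Tate k r) a) {d : Fin m → Γ}
    (hd : ∀ i, ‖(a i : Tate k r)‖ = (d i : PosReal)) :
    InducesIso (quotientNorm I) (Ideal.Quotient.mk I) (quotientNorm_mk_le I)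
      (reductionIdeal (fun i => (a i : Tate k r)) d hd) := by
  set J := reductionIdeal (fun i => (a i : Tate k r)) d hd with hJ
  set ψ := reductionHom (quotientNorm I) (Ideal.Quotient.mk I) (quotientNorm_mk_le I) with hψ
  have hker : ∀ p ∈ J, ψ p = 0 := by
    intro p hp
    refine (Ideal.span_le (I := RingHom.ker ψ)).2 ?_ hp
    rintro _ ⟨i, rfl⟩
    rw [SetLike.mem_coe, RingHom.mem_ker, hψ, reductionHom_polySymbol, symbol_eq_zero_iff,
      Ideal.Quotient.eq_zero_iff_mem.2 (a i).2, UltraSeminorm.map_zero]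
    exact (d i).1.2
  have hhom : ∀ γ, ∀ p ∈ polyDegree k r γ, ψ p = 0 → p ∈ J := by
    intro γ p hp hp0
    obtain ⟨f, hf, rfl⟩ := exists_eq_polySymbol hp
    rw [hψ, reductionHom_polySymbol, symbol_eq_zero_iff] at hp0
    -- The class of `f` has norm `< γ`; its optimal preimage `g` has zero symbol in degree `γ`, so
    -- `f` and `f - g`, the latter in `I`, have the same symbol.
    obtain ⟨g, hg, hgn⟩ := TateAlgebra.exists_mk_eq_norm_eq I hI (Ideal.Quotient.mk I f)
    have hgγ : ‖g‖ < (γ : PosReal) := hgn.trans_lt hp0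
    have hfg : f - g ∈ I := by
      rw [← Ideal.Quotient.eq_zero_iff_mem, map_sub, hg, sub_self]
    have hfgn : ‖f - g‖ ≤ (γ : PosReal) :=
      (norm_sub_le_max_norm f g).trans (max_le hf hgγ.le)
    have hadd := polySymbol_add hfgn hgγ.le (by rwa [sub_add_cancel])
    rw [polySymbol_eq_zero hgγ, add_zero,
      polySymbol_congr rfl (sub_add_cancel f g) _ hf] at hadd
    rw [hadd]
    exact polySymbol_mem_reductionIdeal ha hd hfg hfgn
  have hmem : ∀ γ, ∀ p ∈ polyDegree k r γ, ψ p ∈ degree (quotientNorm I) γ := by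
    intro γ p hp
    obtain ⟨f, hf, rfl⟩ := exists_eq_polySymbol hp
    rw [hψ, reductionHom_polySymbol]
    exact symbol_mem_degree _
  have hsurj : ∀ γ, ∀ y ∈ degree (quotientNorm I) γ, ∃ p ∈ polyDegree k r γ, ψ p = y := by
    intro γ y hy
    obtain ⟨x, hx, rfl⟩ := mem_degree_iff.1 hy
    obtain ⟨f, rfl, hfn⟩ := TateAlgebra.exists_mk_eq_norm_eq I hI x
    have hf : ‖f‖ ≤ (γ : PosReal) := hfn.trans_le hx
    exact ⟨polySymbol γ f hf, polySymbol_mem_polyDegree hf, reductionHom_polySymbol _ hf⟩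
  refine ⟨hker, ⟨RingHom.lift_injective_of_ker_le_ideal _ hker ?_,
    Ideal.Quotient.lift_surjective_of_surjective _ _ ?_⟩, fun γ => ?_⟩
  -- The images of the homogeneous parts lie in distinct degrees, so each part is in the kernel by
  -- itself.
  · intro p hp
    obtain ⟨s, q, hq, rfl⟩ := exists_homogeneous_decomposition r p
    rw [RingHom.mem_ker, map_sum] at hp
    exact J.sum_mem fun γ hγ =>
      hhom γ _ (hq γ) (eq_zero_of_sum_eq_zero_of_mem_degree (fun γ => hmem γ _ (hq γ)) hp γ hγ)
  · intro y
    induction y using DirectSum.induction_on with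
    | zero => exact ⟨0, map_zero _⟩
    | of γ y =>
      obtain ⟨p, -, hp⟩ := hsurj γ.toMul _ ⟨y, rfl⟩
      exact ⟨p, hp⟩
    | add x y hx hy =>
      obtain ⟨p, rfl⟩ := hx
      obtain ⟨q, rfl⟩ := hy
      exact ⟨p + q, map_add _ _ _⟩
  · ext y
    constructor
    · rintro ⟨_, ⟨p, hp, rfl⟩, rfl⟩
      exact hmem γ p hp
    · intro hy
      obtain ⟨p, hp, rfl⟩ := hsurj γ y hy
      exact ⟨_, ⟨p, hp, rfl⟩, rfl⟩

/-! ### Comparison of the quotient norm with the spectral seminorm -/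

theorem UltraSeminorm.ext {A : Type*} [CommRing A] {ν μ : UltraSeminorm A}
    (h : ∀ a, ν a = μ a) : ν = μ := by
  obtain ⟨ν, _, _⟩ := ν
  obtain ⟨μ, _, _⟩ := μ
  obtain rfl : ν = μ := RingSeminorm.ext h
  rfl

theorem InducesIso.of_eq {A : Type*} [CommRing A] {ν μ : UltraSeminorm A} {φ : Tate k r →+* A}
    {hφ : ∀ f, ν (φ f) ≤ ‖f‖} {J : Ideal (MvPolynomial (Fin n) (ResidueField k Γ))}
    (h : InducesIso ν φ hφ J) (hνμ : ν = μ) (hφ' : ∀ f, μ (φ f) ≤ ‖f‖) :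
    InducesIso μ φ hφ' J := by
  subst hνμ
  exact h

theorem UltraSeminorm.spectral_pow {A : Type*} [CommRing A] (ν : UltraSeminorm A) (a : A)
    {m : ℕ} (hm : 1 ≤ m) : ν.spectral (a ^ m) = ν.spectral a ^ m :=
  isPowMul_smoothingFun ν.toRingSeminorm ν.one_le' a hm

theorem UltraSeminorm.spectral_eq_of_pow_eq {A : Type*} [CommRing A] {ν : UltraSeminorm A} {a : A}
    (h : ∀ m, 1 ≤ m → ν (a ^ m) = ν a ^ m) : ν.spectral a = ν a := by
  rw [spectral_apply]
  refine (iInf_congr fun m => ?_).trans (ciInf_const (ι := ℕ+))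
  rw [h m m.2, one_div]
  exact Real.pow_rpow_inv_natCast (ν.nonneg a) m.2.ne'

/-- The symbol of `a` in degree `ν a` is nonzero, hence not nilpotent, so `ν (a ^ m)` cannot drop
below `ν a ^ m`. -/
theorem UltraSeminorm.spectral_eq_of_isGradedReduced {A : Type*} [CommRing A]
    {ν : UltraSeminorm A} (hred : IsGradedReduced (ResidueRing Γ ν) (degree ν)) {a : A} {γ : Γ}
    (ha : ν a = (γ : PosReal)) : ν.spectral a = ν a := by
  refine spectral_eq_of_pow_eq fun m _ => ?_
  obtain ⟨h, hp⟩ := symbol_pow ha.le m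
  have hγ : (((γ ^ m : Γ) : PosReal) : ℝ) = ν a ^ m := by rw [ha]; rfl
  refine (h.trans_eq hγ).antisymm (not_lt.1 fun hlt => ?_)
  rw [(symbol_eq_zero_iff h).2 (hlt.trans_eq hγ.symm)] at hp
  have := hred γ _ (symbol_mem_degree ha.le) ⟨m, hp⟩
  exact ((symbol_eq_zero_iff ha.le).1 this).ne ha

/-- Submultiplicativity for both `c` and `c⁻¹` forces equality. -/
theorem norm_C_mul {ρ : Fin n → PosReal} {I : Ideal (TateAlgebra k ρ)} {c : k} (hc : c ≠ 0)
    (x : TateAlgebra k ρ ⧸ I) :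
    ‖Ideal.Quotient.mk I (TateAlgebra.C c) * x‖ = ‖c‖ * ‖x‖ := by
  have hle : ∀ (c : k) (x : TateAlgebra k ρ ⧸ I),
      ‖Ideal.Quotient.mk I (TateAlgebra.C c) * x‖ ≤ ‖c‖ * ‖x‖ := fun c x =>
    (norm_mul_le _ _).trans (mul_le_mul_of_nonneg_right
      ((Ideal.Quotient.norm_mk_le I _).trans (TateAlgebra.norm_C_le c)) (norm_nonneg x))
  refine (hle c x).antisymm ?_
  have h := hle c⁻¹ (Ideal.Quotient.mk I (TateAlgebra.C c) * x)
  rw [← mul_assoc, ← map_mul, ← map_mul, inv_mul_cancel₀ hc, map_one, map_one, one_mul, norm_inv,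
    ← div_eq_inv_mul, le_div_iff₀' (norm_pos_iff.2 hc)] at h
  exact h

theorem spectral_eq_quotientNorm (hI : IsClosed (I : Set (Tate k r)))
    (hred : IsGradedReduced (ResidueRing Γ (quotientNorm I)) (degree (quotientNorm I))) :
    quotientNorm I = (quotientNorm I).spectral := by
  refine UltraSeminorm.ext fun x => ?_
  obtain ⟨c, γ, hx⟩ := quotientNorm_eq_norm_mul hI x
  by_cases hc : c = 0
  · rw [hc, norm_zero, zero_mul] at hx
    rw [hx]
    exact ((UltraSeminorm.nonneg _ _).antisymm ((UltraSeminorm.spectral_le _ x).trans_eq hx))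
  have hc' : 0 < ‖c‖ := norm_pos_iff.2 hc
  -- The residue ring sees only degrees in `Γ`, so `x` of norm `‖c‖ * γ` is rescaled to norm `γ`.
  set y := Ideal.Quotient.mk I (TateAlgebra.C c⁻¹) * x with hy
  have hxy : x = Ideal.Quotient.mk I (TateAlgebra.C c) * y := by
    rw [hy, ← mul_assoc, ← map_mul, ← map_mul, mul_inv_cancel₀ hc, map_one, map_one, one_mul]
  have hyn : quotientNorm I y = (γ : PosReal) := by
    have h : quotientNorm I y = ‖c⁻¹‖ * quotientNorm I x := norm_C_mul (inv_ne_zero hc) x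
    rw [h, hx, norm_inv, inv_mul_cancel_left₀ hc'.ne']
  have hysp := UltraSeminorm.spectral_eq_of_isGradedReduced hred hyn
  refine le_antisymm ?_ (UltraSeminorm.spectral_le _ x)
  have h1 : (quotientNorm I).spectral y ≤ ‖c‖⁻¹ * (quotientNorm I).spectral x := by
    refine ((quotientNorm I).spectral.mul_le' _ _).trans
      (mul_le_mul_of_nonneg_right ?_ (UltraSeminorm.nonneg _ _))
    rw [← norm_inv]
    exact (spectral_mk_le I _).trans (TateAlgebra.norm_C_le _)
  rw [hysp, hyn, ← div_eq_inv_mul, le_div_iff₀' hc', ← hx] at h1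
  exact h1

theorem quotientNorm_eq_spectral_of_isDistinguished
    (h : IsDistinguished (quotientNorm I) (Ideal.Quotient.mk I)) :
    quotientNorm I = (quotientNorm I).spectral := by
  refine UltraSeminorm.ext fun x => le_antisymm ?_ (UltraSeminorm.spectral_le _ x)
  obtain ⟨b, rfl, hb⟩ := h x
  rw [← hb]
  exact quotientNorm_mk_le I b

end Quotient

end GradedReduction

end

theorem mainTheorem11 {k : Type*} [NormedField k] [IsUltrametricDist k] [CompleteSpace k]
    (Γ : Subgroup GradedReduction.PosReal) {n m : ℕ} (r : Fin n → Γ)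
    (I : Ideal (GradedReduction.Tate k r)) (a : Fin m → I)
    (ha : GradedReduction.IsStronglyGenerating (GradedReduction.Tate k r) a)
    (d : Fin m → Γ)
    (hd : ∀ i, ‖(a i : GradedReduction.Tate k r)‖ = (d i : GradedReduction.PosReal)) :
    -- the quotient norm is a submultiplicative norm with values in `|k| ⬝ Γ`
    ((∀ x y, GradedReduction.quotientNorm I (x * y) ≤
        GradedReduction.quotientNorm I x * GradedReduction.quotientNorm I y) ∧
      (∀ x, GradedReduction.quotientNorm I x = 0 → x = 0) ∧
      (∀ x, ∃ (c : k) (γ : Γ), GradedReduction.quotientNorm I x =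
        ‖c‖ * ((γ : GradedReduction.PosReal) : ℝ))) ∧
    -- its residue ring
    GradedReduction.InducesIso (GradedReduction.quotientNorm I) (Ideal.Quotient.mk I)
      (GradedReduction.quotientNorm_mk_le I)
      (GradedReduction.reductionIdeal (fun i => (a i : GradedReduction.Tate k r)) d hd) ∧
    -- the three equivalent conditions
    List.TFAE
      [GradedReduction.IsDistinguished (GradedReduction.quotientNorm I) (Ideal.Quotient.mk I),
       GradedReduction.InducesIso (GradedReduction.quotientNorm I).spectral (Ideal.Quotient.mk I)
        (GradedReduction.spectral_mk_le I)
        (GradedReduction.reductionIdeal (fun i => (a i : GradedReduction.Tate k r)) d hd),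
       GradedReduction.IsGradedReduced
        (MvPolynomial (Fin n) (GradedReduction.ResidueField k Γ) ⧸
          GradedReduction.reductionIdeal (fun i => (a i : GradedReduction.Tate k r)) d hd)
        (GradedReduction.quotientDegree (GradedReduction.polyDegree k r)
          (GradedReduction.reductionIdeal (fun i => (a i : GradedReduction.Tate k r)) d hd))] := by
  open GradedReduction in
  have hI := TateAlgebra.isClosed_of_isStronglyGenerating I a ha
  have hiso := inducesIso_quotientNorm hI ha hd
  refine ⟨⟨fun x y => (quotientNorm I).mul_le' x y, fun x hx => ?_,
    quotientNorm_eq_norm_mul hI⟩, hiso, ?_⟩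
  · obtain ⟨f, rfl, hf⟩ := TateAlgebra.exists_mk_eq_norm_eq I hI x
    rw [norm_eq_zero.1 (hf.trans hx), map_zero]
  -- A distinguished surjection makes the two seminorms equal, and the isomorphism already obtained
  -- applies.
  tfae_have 1 → 2 := fun h =>
    hiso.of_eq (quotientNorm_eq_spectral_of_isDistinguished h) (spectral_mk_le I)
  tfae_have 2 → 3 := fun ⟨_, h⟩ => h.isGradedReduced
    (ResidueRing.isGradedReduced_of_isPowMul fun a _ hm => (quotientNorm I).spectral_pow a hm)
  tfae_have 3 → 1 := by
    intro h x
    obtain ⟨_, hiso⟩ := hiso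
    -- Reducedness passes through the isomorphism to the residue ring of the quotient norm; once the
    -- seminorms agree, an optimal preimage is a distinguished one.
    rw [← spectral_eq_quotientNorm hI (hiso.isGradedReduced_target h)]
    exact TateAlgebra.exists_mk_eq_norm_eq I hI x
  tfae_finish
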